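/- Let $p$ be an odd prime, $\Lambda=\mathbb{Z}_p[[T]]$, $\omega_n=(1+T)^{p^n}-1$, and let $\iota$ be the involution $T\mapsto (1+T)^{-1}-1$ of the $\mathbb{Z}_p$-algebra $\Lambda$. Put $\xi_0=\omega_0=T$ and $\xi_{k}=\omega_{k}/\omega_{k-1}$ for $k\ge 1$. For a discrete $\Lambda$-module $M$ let $M^\vee=\mathrm{Hom}(M,\mathbb{Q}_p/\mathbb{Z}_p)$ with action $(f\cdot\phi)(m)=\phi(\iota(f)m)$, and for a $\Lambda$-module $M$ let $M^\iota$ be $M$ with the action twisted by $\iota$. For a finitely generated $\Lambda$-module $X$ define $$\mathfrak{F}(X)=\Big(\varinjlim_n \tfrac{X}{\omega_nX}[p^\infty]\Big)^\vee,\qquad \mathfrak{G}(X)=\varprojlim_n \Big(\tfrac{X}{\omega_nX}[p^\infty]\Big),$$ where the direct limit is taken along the norm maps $\frac{X}{\omega_nX}\xrightarrow{\times\,\omega_{n+1}/\omega_n}\frac{X}{\omega_{n+1}X}$ and the inverse limit along the natural projections. A pseudo-isomorphism is a $\Lambda$-linear map with finite kernel and finite cokernel. Let $X$ be a finitely generated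 $\Lambda$-module. (1) Suppose that there is a pseudo-isomorphism $$X\longrightarrow \Lambda^{r}\oplus\bigoplus_{i=1}^{d}\frac{\Lambda}{g_i^{l_i}}\oplus\bigoplus_{m=1}^{f}\frac{\Lambda}{\xi_{a_m}^{e_m}}\oplus\bigoplus_{n=1}^{t}\frac{\Lambda}{\xi_{b_n}},$$ where $r,d,f,t\ge 0$, the $g_i$ are prime elements of $\Lambda$ coprime to $\omega_n$ for all $n\ge 0$, $l_i\ge 1$, $e_m\ge 2$ and $a_m,b_n\ge 0$. Then there is an injective $\Lambda$-linear map with finite cokernel $$\bigoplus_{i=1}^{d}\frac{\Lambda}{\iota(g_i)^{l_i}}\oplus\bigoplus_{m=1}^{f}\frac{\Lambda}{\iota(\xi_{a_m})^{e_m-1}}\hookrightarrow\mathfrak{F}(X).$$ (2) $\mathfrak{F}(X)$ is a finitely generated torsion $\Lambda$-module. (3) $\mathfrak{F}(X)^\iota$ and $\mathfrak{G}(X)$ are pseudo-isomorphic: there are pseudo-isomorphisms $\mathfrak{F}(X)^\iota\to\mathfrak{G}(X)$ and $\mathfrak{G}(X)\to\mathfrak{F}(X)^\iota$. -/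

import Mathlib

namespace IwasawaFunctors

noncomputable section

/-- The Iwasawa algebra `Λ = ℤ_p⟦T⟧`; the variable `T` is `PowerSeries.X`. -/
abbrev Lam (p : ℕ) [Fact p.Prime] : Type := PowerSeries ℤ_[p]

/-- `ω_n = (1 + T)^(p^n) - 1`. -/
def omega (p : ℕ) [Fact p.Prime] (n : ℕ) : Lam p := (1 + PowerSeries.X) ^ p ^ n - 1

/-- `ω_{m,n} = ω_m / ω_n` for `n ≤ m`, written as the geometric sum
`∑_{k < p^(m-n)} (1 + T)^(k p^n)`; see `omegaQuot_mul_omega`. -/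
def omegaQuot (p : ℕ) [Fact p.Prime] (m n : ℕ) : Lam p :=
  ∑ k ∈ Finset.range (p ^ (m - n)), ((1 + PowerSeries.X) ^ p ^ n) ^ k

theorem omegaQuot_mul_omega (p : ℕ) [Fact p.Prime] {m n : ℕ} (h : n ≤ m) :
    omegaQuot p m n * omega p n = omega p m := by
  unfold omegaQuot omega
  rw [geom_sum_mul, ← pow_mul, ← pow_add, Nat.add_sub_cancel' h]

theorem omega_ne_zero (p : ℕ) [Fact p.Prime] (n : ℕ) : omega p n ≠ 0 := by
  intro h
  have hp : p ^ n ≠ 0 := pow_ne_zero _ (Fact.out : p.Prime).ne_zero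
  have h1 : (1 + PowerSeries.X : Lam p) ^ p ^ n = 1 := sub_eq_zero.mp h
  have h2 : (((1 + Polynomial.X) ^ p ^ n : Polynomial ℤ_[p]) : PowerSeries ℤ_[p])
      = ((1 : Polynomial ℤ_[p]) : PowerSeries ℤ_[p]) := by
    simpa using h1
  have h3 := congrArg (fun q : Polynomial ℤ_[p] => Polynomial.coeff q (p ^ n))
    (Polynomial.coe_injective _ h2)
  rw [Polynomial.coeff_one_add_X_pow, Polynomial.coeff_one, if_neg hp, Nat.choose_self,
    Nat.cast_one] at h3
  exact one_ne_zero h3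

theorem omegaQuot_mul_omegaQuot (p : ℕ) [Fact p.Prime] {l m n : ℕ} (h : n ≤ m) (h' : m ≤ l) :
    omegaQuot p l m * omegaQuot p m n = omegaQuot p l n := by
  apply mul_right_cancel₀ (omega_ne_zero p n)
  rw [mul_assoc, omegaQuot_mul_omega p h, omegaQuot_mul_omega p h',
    omegaQuot_mul_omega p (h.trans h')]

theorem omegaQuot_self (p : ℕ) [Fact p.Prime] (n : ℕ) : omegaQuot p n n = 1 := by
  simp [omegaQuot]

/-- The cyclotomic factors of the `ω_n`: `ξ_0 = ω_0 = T` and `ξ_(k+1) = ω_{k+1,k}`, so that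
`ω_n = ξ_0 ξ_1 ⋯ ξ_n`. -/
def xi (p : ℕ) [Fact p.Prime] : ℕ → Lam p
  | 0 => omega p 0
  | k + 1 => omegaQuot p (k + 1) k

theorem prod_xi (p : ℕ) [Fact p.Prime] (n : ℕ) :
    ∏ k ∈ Finset.range (n + 1), xi p k = omega p n := by
  induction n with
  | zero => simp [xi]
  | succ n ih =>
    rw [Finset.prod_range_succ, ih, mul_comm]
    exact omegaQuot_mul_omega p n.le_succ

/-- The power series `(1 + T)⁻¹ - 1`. -/
def iotaT (p : ℕ) [Fact p.Prime] : Lam p := PowerSeries.invOfUnit (1 + PowerSeries.X) 1 - 1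

theorem one_add_X_mul_one_add_iotaT (p : ℕ) [Fact p.Prime] :
    (1 + PowerSeries.X) * (1 + iotaT p) = 1 := by
  unfold iotaT
  rw [add_sub_cancel]
  exact PowerSeries.mul_invOfUnit _ _ (by simp)

theorem hasSubst_iotaT (p : ℕ) [Fact p.Prime] : PowerSeries.HasSubst (iotaT p) :=
  PowerSeries.HasSubst.of_constantCoeff_zero' (by simp [iotaT])

/-- The involution `ι` of `Λ`, the substitution `T ↦ (1 + T)⁻¹ - 1`. -/
def iota (p : ℕ) [Fact p.Prime] : Lam p →ₐ[ℤ_[p]] Lam p :=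
  PowerSeries.substAlgHom (hasSubst_iotaT p)

/-- The module `M^ι`: the same group `M`, on which `f` acts as `ι(f)` acts on `M`. -/
def Twist (p : ℕ) [Fact p.Prime] (M : Type*) : Type _ := M

instance (p : ℕ) [Fact p.Prime] (M : Type*) [AddCommGroup M] : AddCommGroup (Twist p M) :=
  inferInstanceAs (AddCommGroup M)

instance (p : ℕ) [Fact p.Prime] (M : Type*) [AddCommGroup M] [Module (Lam p) M] :
    Module (Lam p) (Twist p M) :=
  Module.compHom M (iota p : Lam p →+* Lam p)

/-- The group `ℚ_p / ℤ_p`. -/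
abbrev QpModZp (p : ℕ) [Fact p.Prime] : Type :=
  ℚ_[p] ⧸ (PadicInt.subring p).toAddSubgroup

/-- The Pontryagin dual `Hom_cts(M, ℚ_p / ℤ_p)` of a discrete `Λ`-module `M`
(every homomorphism from a discrete group is continuous). -/
def Dual (p : ℕ) [Fact p.Prime] (M : Type*) [AddCommGroup M] : Type _ := M →+ QpModZp p

instance (p : ℕ) [Fact p.Prime] (M : Type*) [AddCommGroup M] : AddCommGroup (Dual p M) :=
  inferInstanceAs (AddCommGroup (M →+ QpModZp p))

/-- The action on the dual is `(f • φ)(m) = φ(ι(f) • m)`. -/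
instance (p : ℕ) [Fact p.Prime] (M : Type*) [AddCommGroup M] [Module (Lam p) M] :
    Module (Lam p) (Dual p M) where
  smul f φ := AddMonoidHom.comp (show M →+ QpModZp p from φ)
    (DistribSMul.toAddMonoidHom M (iota p f))
  one_smul φ := AddMonoidHom.ext fun m =>
    congrArg (show M →+ QpModZp p from φ) (by simp)
  mul_smul f g φ := AddMonoidHom.ext fun m =>
    congrArg (show M →+ QpModZp p from φ)
      (show iota p (f * g) • m = iota p g • iota p f • m by
        rw [map_mul, mul_comm, mul_smul])
  smul_zero f := rfl
  smul_add f φ ψ := rfl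
  add_smul f g φ := AddMonoidHom.ext fun m =>
    (congrArg (show M →+ QpModZp p from φ)
      (show iota p (f + g) • m = iota p f • m + iota p g • m by rw [map_add, add_smul])).trans
      (map_add (show M →+ QpModZp p from φ) _ _)
  zero_smul φ := AddMonoidHom.ext fun m =>
    (congrArg (show M →+ QpModZp p from φ)
      (show iota p 0 • m = 0 by rw [map_zero, zero_smul])).trans
      (map_zero (show M →+ QpModZp p from φ))

/-- The submodule `ω_n X` of `X`. -/
abbrev omegaSub (p : ℕ) [Fact p.Prime] (X : Type*) [AddCommGroup X] [Module (Lam p) X] (n : ℕ) :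
    Submodule (Lam p) X :=
  LinearMap.range (LinearMap.lsmul (Lam p) X (omega p n))

/-- The submodule `M[p^∞]` of the elements killed by a power of `p`. -/
abbrev pPrimary (p : ℕ) [Fact p.Prime] (M : Type*) [AddCommGroup M] [Module (Lam p) M] :
    Submodule (Lam p) M :=
  Submodule.torsion' (Lam p) M (Submonoid.powers (p : Lam p))

/-- A linear map carries `p`-power torsion to `p`-power torsion. -/
theorem map_pPrimary (p : ℕ) [Fact p.Prime] {M N : Type*} [AddCommGroup M] [Module (Lam p) M]
    [AddCommGroup N] [Module (Lam p) N] (u : M →ₗ[Lam p] N) :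
    ∀ x ∈ pPrimary p M, u x ∈ pPrimary p N := by
  rintro x ⟨a, ha⟩
  refine ⟨a, ?_⟩
  have h : u ((a : Lam p) • x) = 0 := by
    rw [show (a : Lam p) • x = 0 from ha, map_zero]
  rw [map_smul] at h
  exact h

/-- The group `(X / ω_n X)[p^∞]`. -/
abbrev level (p : ℕ) [Fact p.Prime] (X : Type*) [AddCommGroup X] [Module (Lam p) X] (n : ℕ) :
    Type _ :=
  pPrimary p (X ⧸ omegaSub p X n)

/-- Multiplication by `ω_m / ω_n`, as a map `X / ω_n X → X / ω_m X` for `n ≤ m`. -/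
def normQuot (p : ℕ) [Fact p.Prime] (X : Type*) [AddCommGroup X] [Module (Lam p) X] (n m : ℕ)
    (h : n ≤ m) : (X ⧸ omegaSub p X n) →ₗ[Lam p] (X ⧸ omegaSub p X m) :=
  Submodule.mapQ _ _ (LinearMap.lsmul (Lam p) X (omegaQuot p m n)) (by
    rintro _ ⟨x, rfl⟩
    refine ⟨x, ?_⟩
    simp only [LinearMap.lsmul_apply]
    rw [smul_smul, omegaQuot_mul_omega p h])

/-- The norm maps `(X / ω_n X)[p^∞] → (X / ω_m X)[p^∞]`. -/
def normMap (p : ℕ) [Fact p.Prime] (X : Type*) [AddCommGroup X] [Module (Lam p) X] (n m : ℕ)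
    (h : n ≤ m) : level p X n →ₗ[Lam p] level p X m :=
  (normQuot p X n m h).restrict (map_pPrimary p (normQuot p X n m h))

/-- The norm maps form a directed system. -/
instance (p : ℕ) [Fact p.Prime] (X : Type*) [AddCommGroup X] [Module (Lam p) X] :
    DirectedSystem (level p X) (fun n m h => normMap p X n m h) where
  map_self n := by
    rintro ⟨x, hx⟩
    obtain ⟨x, rfl⟩ := Submodule.Quotient.mk_surjective _ x
    apply Subtype.ext
    change Submodule.Quotient.mk (omegaQuot p n n • x) = Submodule.Quotient.mk x
    rw [omegaQuot_self, one_smul]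
  map_map n m l h h' := by
    rintro ⟨x, hx⟩
    obtain ⟨x, rfl⟩ := Submodule.Quotient.mk_surjective _ x
    apply Subtype.ext
    change Submodule.Quotient.mk (omegaQuot p _ _ • omegaQuot p _ _ • x)
      = Submodule.Quotient.mk (omegaQuot p _ _ • x)
    rw [smul_smul, omegaQuot_mul_omegaQuot p h h']

/-- `𝔉(X) = (lim_→ (X / ω_n X)[p^∞])^∨`, the direct limit (a discrete module) being taken along
the norm maps. -/
abbrev F (p : ℕ) [Fact p.Prime] (X : Type*) [AddCommGroup X] [Module (Lam p) X] : Type _ :=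
  Dual p (Module.DirectLimit (level p X) (normMap p X))

/-- The canonical projection `X / ω_m X → X / ω_n X` for `n ≤ m`. -/
def projQuot (p : ℕ) [Fact p.Prime] (X : Type*) [AddCommGroup X] [Module (Lam p) X] (n m : ℕ)
    (h : n ≤ m) : (X ⧸ omegaSub p X m) →ₗ[Lam p] (X ⧸ omegaSub p X n) :=
  Submodule.factor (by
    rintro _ ⟨x, rfl⟩
    refine ⟨omegaQuot p m n • x, ?_⟩
    simp only [LinearMap.lsmul_apply]
    rw [smul_smul, mul_comm, omegaQuot_mul_omega p h])

/-- The projections `(X / ω_m X)[p^∞] → (X / ω_n X)[p^∞]`. -/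
def proj (p : ℕ) [Fact p.Prime] (X : Type*) [AddCommGroup X] [Module (Lam p) X] (n m : ℕ)
    (h : n ≤ m) : level p X m →ₗ[Lam p] level p X n :=
  (projQuot p X n m h).restrict (map_pPrimary p (projQuot p X n m h))

/-- `𝔊(X) = lim_← (X / ω_n X)[p^∞]`, the module of families compatible with the projections. -/
def G (p : ℕ) [Fact p.Prime] (X : Type*) [AddCommGroup X] [Module (Lam p) X] :
    Submodule (Lam p) (∀ n, level p X n) where
  carrier := {x | ∀ n m (h : n ≤ m), proj p X n m h (x m) = x n}
  zero_mem' n m h := map_zero _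
  add_mem' {x y} hx hy n m h := by
    rw [Pi.add_apply, Pi.add_apply, map_add, hx n m h, hy n m h]
  smul_mem' c x hx n m h := by
    rw [Pi.smul_apply, Pi.smul_apply, map_smul, hx n m h]

/-- There is a pseudo-isomorphism `M → N` of `Λ`-modules, that is, a `Λ`-linear map with finite
kernel and finite cokernel. -/
def HasPseudoIso (p : ℕ) [Fact p.Prime] (M N : Type*) [AddCommGroup M] [Module (Lam p) M]
    [AddCommGroup N] [Module (Lam p) N] : Prop :=
  ∃ u : M →ₗ[Lam p] N, Finite (LinearMap.ker u) ∧ Finite (N ⧸ LinearMap.range u)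

/-- `Λ / (f)`. -/
abbrev cyc {p : ℕ} [Fact p.Prime] (f : Lam p) : Type := Lam p ⧸ Ideal.span {f}

end

end IwasawaFunctors

/-!
Both functors are computed up to finite groups on the elementary module to which `X` is
pseudo-isomorphic, where they become a statement about cyclic modules.

*Invariance.* A pseudo-isomorphism `X → Y` induces an injection `𝔉(Y) → 𝔉(X)` with finite cokernel
(`FMap_injective`, `finite_coker_FMap`). The reason is that the norm maps are multiplications by
elements of high powers of the maximal ideal, which kill every finite module; so the direct limit of
the `(X / ω_n X)[p^∞]` maps onto that of `Y`, with a finite kernel. As `X` is compact, `𝔊(X)` is the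
submodule `core p X` of the elements of `X` that are `p`-power torsion modulo every `ω_n`
(`coreEquiv`), and a pseudo-isomorphism `X → Y` restricts to one of these submodules
(`hasPseudoIso_core`).

*Cyclic modules.* Let `X = Λ / (h c)` where `c` divides `ω_n = c θ_n` and `h` is coprime to `θ_n`, for
large `n`. Then the `p`-power torsion of `X / ω_n X` is `c Λ / (h c, c θ_n) ≃ Λ / (h, θ_n)`, a finite
complete intersection, and therefore has a simple socle (`simpleSocle_span_pair`). A character of the
union of these modules that is nontrivial on the socle generates the dual
(`exists_character_generator`), so that `𝔉(X) ≃ Λ / ι(h)` (`nonempty_F_cyc_equiv`), while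
`𝔊(X) ≃ Λ / h` (`nonempty_core_cyc_equiv`). Since `ω_n` is squarefree
(`isRelPrime_of_mul_eq_omega`), this applies to all prime powers: for `g` coprime to all `ω_n` one
has `c = 1`, and for `ξ_a ^ e` one has `c = ξ_a` and `h = ξ_a ^ (e - 1)`. Free modules contribute
nothing.

*Structure theorem.* That every finitely generated `X` has a pseudo-isomorphism to an elementary
module (`exists_hasPseudoIso_elementary`) is shown by combining two maps. The module `Hom(X, Λ)` is
free, and evaluation maps `X` to its dual with finite cokernel and torsion kernel
(`exists_basis_functionals`, `finite_coker_pi_functionals`). The torsion part comes from the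
localization of `Λ` at the finitely many primes of height one that divide an annihilator of the
torsion, which is a principal ideal domain (`exists_map_elementary_localization`). Finiteness is
checked throughout by the criterion that a finitely generated module killed by two coprime elements
is finite (`finite_of_isRelPrime`).

*Symmetry.* This gives a pseudo-isomorphism from `𝔊(X)` to `𝔉(X)^ι` through the direct sum of the
`Λ / h`; one in the other direction exists because both modules are finitely generated and torsion
(`HasPseudoIso.symm`).
-/

namespace IwasawaFunctors

open IsLocalRing

noncomputable section

variable {p : ℕ} [Fact p.Prime]

/-! ### Ring theory of the Iwasawa algebra -/

theorem natCast_eq_C : (p : Lam p) = PowerSeries.C (p : ℤ_[p]) := by simp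

theorem natCast_dvd_iff {f : Lam p} :
    (p : Lam p) ∣ f ↔ ∀ n, (p : ℤ_[p]) ∣ PowerSeries.coeff n f := by
  rw [natCast_eq_C]
  constructor
  · rintro ⟨g, rfl⟩ n
    rw [PowerSeries.coeff_C_mul]
    exact dvd_mul_right _ _
  · intro h
    choose g hg using h
    refine ⟨PowerSeries.mk g, PowerSeries.ext fun n => ?_⟩
    rw [PowerSeries.coeff_C_mul, PowerSeries.coeff_mk, hg n]

theorem natCast_dvd_iff_map_eq_zero {f : Lam p} :
    (p : Lam p) ∣ f ↔ PowerSeries.map (residue ℤ_[p]) f = 0 := by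
  rw [natCast_dvd_iff, PowerSeries.ext_iff]
  refine forall_congr' fun n => ?_
  rw [PowerSeries.coeff_map, map_zero, residue_eq_zero_iff, PadicInt.maximalIdeal_eq_span_p,
    Ideal.mem_span_singleton]

theorem prime_natCast : Prime (p : Lam p) := by
  refine ⟨fun h => ?_, fun h => ?_, fun a b h => ?_⟩
  · have := congrArg (PowerSeries.constantCoeff (R := ℤ_[p])) h
    rw [map_natCast, map_zero] at this
    exact PadicInt.prime_p.ne_zero this
  · have := h.map (PowerSeries.constantCoeff (R := ℤ_[p]))
    rw [map_natCast] at this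
    exact PadicInt.prime_p.not_isUnit this
  · simp only [natCast_dvd_iff_map_eq_zero, map_mul, mul_eq_zero] at h ⊢
    exact h

theorem isRelPrime_natCast_X : IsRelPrime (p : Lam p) PowerSeries.X := by
  refine (prime_natCast.irreducible.isRelPrime_iff_not_dvd).mpr fun h => ?_
  have h1 := natCast_dvd_iff.mp h 1
  rw [PowerSeries.coeff_one_X] at h1
  exact PadicInt.prime_p.not_isUnit (isUnit_of_dvd_one h1)

theorem mem_maximalIdeal_iff {f : Lam p} :
    f ∈ maximalIdeal (Lam p) ↔ (p : ℤ_[p]) ∣ PowerSeries.constantCoeff f := by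
  rw [mem_maximalIdeal, mem_nonunits_iff, PowerSeries.isUnit_iff_constantCoeff,
    ← mem_nonunits_iff, ← mem_maximalIdeal, PadicInt.maximalIdeal_eq_span_p,
    Ideal.mem_span_singleton]

theorem natCast_mem_maximalIdeal : (p : Lam p) ∈ maximalIdeal (Lam p) := by
  rw [mem_maximalIdeal_iff, map_natCast]

theorem X_mem_maximalIdeal : (PowerSeries.X : Lam p) ∈ maximalIdeal (Lam p) := by
  rw [mem_maximalIdeal_iff, PowerSeries.constantCoeff_X]
  exact dvd_zero _

theorem maximalIdeal_eq_span :
    maximalIdeal (Lam p) = Ideal.span {(p : Lam p), PowerSeries.X} := by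
  apply le_antisymm
  · intro f hf
    obtain ⟨c, hc⟩ := mem_maximalIdeal_iff.mp hf
    obtain ⟨g, hg⟩ := PowerSeries.X_dvd_iff.mpr
      (show PowerSeries.constantCoeff (f - PowerSeries.C (PowerSeries.constantCoeff f)) = 0 by simp)
    refine Ideal.mem_span_pair.mpr ⟨PowerSeries.C c, g, ?_⟩
    rw [mul_comm g, ← hg, hc, map_mul, natCast_eq_C]
    ring
  · rw [Ideal.span_le]
    rintro f (rfl | rfl)
    exacts [natCast_mem_maximalIdeal, X_mem_maximalIdeal]

instance finite_residue : Finite (Lam p ⧸ maximalIdeal (Lam p)) := by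
  have h1 : Finite (ResidueField ℤ_[p]) := Finite.of_equiv _ PadicInt.residueField.symm.toEquiv
  let u : Lam p →+* ResidueField ℤ_[p] := (residue ℤ_[p]).comp PowerSeries.constantCoeff
  have hu : RingHom.ker u = maximalIdeal (Lam p) := by
    ext f
    rw [RingHom.mem_ker, mem_maximalIdeal_iff, RingHom.comp_apply, residue_eq_zero_iff,
      PadicInt.maximalIdeal_eq_span_p, Ideal.mem_span_singleton]
  rw [← hu]
  exact Finite.of_injective _ (RingHom.kerLift_injective u)

/-- A finitely generated module killed by a power of the maximal ideal is finite. -/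
theorem finite_of_pow_maximalIdeal (M : Type*) [AddCommGroup M] [Module (Lam p) M]
    [Module.Finite (Lam p) M] (k : ℕ) (h : ∀ a ∈ maximalIdeal (Lam p) ^ k, ∀ x : M, a • x = 0) :
    Finite M := by
  have h1 : Finite (Lam p ⧸ maximalIdeal (Lam p) ^ k) :=
    Ideal.finite_quotient_pow (IsNoetherian.noetherian _) k
  let _ : Module (Lam p ⧸ maximalIdeal (Lam p) ^ k) M :=
    Module.IsTorsionBySet.module (fun x a => h a a.2 x)
  have _ : IsScalarTower (Lam p) (Lam p ⧸ maximalIdeal (Lam p) ^ k) M :=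
    Module.IsTorsionBySet.isScalarTower (fun x a => h a a.2 x)
  have : Module.Finite (Lam p ⧸ maximalIdeal (Lam p) ^ k) M :=
    Module.Finite.of_restrictScalars_finite (Lam p) _ _
  exact Module.finite_of_finite (Lam p ⧸ maximalIdeal (Lam p) ^ k)

/-- A finite module is killed by a power of the maximal ideal. -/
theorem exists_pow_maximalIdeal_smul (M : Type*) [AddCommGroup M] [Module (Lam p) M] [Finite M] :
    ∃ k : ℕ, ∀ a ∈ maximalIdeal (Lam p) ^ k, ∀ x : M, a • x = 0 := by
  let f : ℕ →o (Submodule (Lam p) M)ᵒᵈ :=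
    ⟨fun k => OrderDual.toDual (maximalIdeal (Lam p) ^ k • ⊤), fun i j h =>
      Submodule.smul_mono_left (Ideal.pow_le_pow_right h)⟩
  obtain ⟨k, hk⟩ := IsArtinian.monotone_stabilizes f
  refine ⟨k, fun a ha x => ?_⟩
  have h2 : (maximalIdeal (Lam p) ^ k • ⊤ : Submodule (Lam p) M) = ⊥ := by
    have hk1 : (maximalIdeal (Lam p) ^ k • ⊤ : Submodule (Lam p) M)
        = maximalIdeal (Lam p) ^ (k + 1) • ⊤ := hk (k + 1) k.le_succ
    apply Submodule.eq_bot_of_le_smul_of_le_jacobson_bot (maximalIdeal (Lam p)) _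
      (IsNoetherian.noetherian _) _ (maximalIdeal_le_jacobson _)
    rw [← Submodule.mul_smul, ← pow_succ']
    exact hk1.le
  have h3 : a • x ∈ (maximalIdeal (Lam p) ^ k • ⊤ : Submodule (Lam p) M) :=
    Submodule.smul_mem_smul ha trivial
  rwa [h2] at h3

/-- By Weierstrass preparation, modulo `p` an element not divisible by `p` is a unit times a power of
`T`. -/
theorem X_pow_mem_span {g : Lam p} (hg : ¬ (p : Lam p) ∣ g) :
    ∃ n, (PowerSeries.X : Lam p) ^ n ∈ Ideal.span {(p : Lam p), g} := by
  have h0 : PowerSeries.map (residue ℤ_[p]) g ≠ 0 := fun h => hg (natCast_dvd_iff_map_eq_zero.mpr h)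
  obtain ⟨f, u, H⟩ := PowerSeries.exists_isWeierstrassFactorization h0
  have h1 : (p : Lam p) ∣ (f : Lam p) - PowerSeries.X ^ f.natDegree := by
    rw [natCast_dvd_iff_map_eq_zero, map_sub, map_pow, PowerSeries.map_X, sub_eq_zero]
    ext n
    rw [PowerSeries.coeff_map, Polynomial.coeff_coe, PowerSeries.coeff_X_pow]
    rcases lt_trichotomy n f.natDegree with h | h | h
    · rw [if_neg h.ne, residue_eq_zero_iff]
      exact H.isDistinguishedAt.mem h
    · rw [if_pos h, h, show f.coeff f.natDegree = 1 from H.isDistinguishedAt.monic, map_one]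
    · rw [if_neg h.ne', Polynomial.coeff_eq_zero_of_natDegree_lt h, map_zero]
  obtain ⟨c, hc⟩ := h1
  obtain ⟨v, hv⟩ := H.isUnit.exists_right_inv
  refine ⟨f.natDegree, Ideal.mem_span_pair.mpr ⟨-c, v, ?_⟩⟩
  rw [H.eq_mul]
  linear_combination (f : Lam p) * hv + hc

/-- A prime ideal containing two coprime elements is the maximal ideal. -/
theorem maximalIdeal_le_of_isRelPrime {P : Ideal (Lam p)} [hP : P.IsPrime] {a b : Lam p}
    (ha : a ∈ P) (hb : b ∈ P) (h : IsRelPrime a b) : maximalIdeal (Lam p) ≤ P := by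
  wlog ha0 : a ≠ 0 generalizing a b
  · refine this hb ha h.symm fun hb0 => ?_
    rw [not_not] at ha0
    exact not_isUnit_zero (h (d := 0) (by rw [ha0]) (by rw [hb0]))
  -- a prime factor `q` of `a` lies in `P`, and does not divide `b`
  obtain ⟨q, hqP, hq, hqb⟩ : ∃ q ∈ P, Prime q ∧ ¬ q ∣ b := by
    obtain ⟨q, hq, hqP⟩ := (hP.multiset_prod_mem_iff_exists_mem _).mp (show
      (UniqueFactorizationMonoid.factors a).prod ∈ P by
        obtain ⟨u, hu⟩ := (UniqueFactorizationMonoid.factors_prod ha0).symm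
        rw [← hu]
        exact P.mul_mem_right _ ha)
    have hqp := UniqueFactorizationMonoid.prime_of_factor q hq
    exact ⟨q, hqP, hqp, fun hb' => hqp.not_isUnit
      (h (UniqueFactorizationMonoid.dvd_of_mem_factors hq) hb')⟩
  have key : (p : Lam p) ∈ P := by
    by_cases hpq : (p : Lam p) ∣ q
    · obtain ⟨u, hu⟩ := (prime_natCast.dvd_prime_iff_associated hq).mp hpq
      rw [← hu] at hqP
      exact (hP.mem_or_mem hqP).resolve_right fun h' => hP.ne_top (Ideal.eq_top_of_isUnit_mem _ h' u.isUnit)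
    -- `Λ / q` is finite over `ℤ_p`, so that the nonzero prime `P / q` meets `ℤ_p`
    have h0 : PowerSeries.map (residue ℤ_[p]) q ≠ 0 :=
      fun h => hpq (natCast_dvd_iff_map_eq_zero.mpr h)
    obtain ⟨f, u, H⟩ := PowerSeries.exists_isWeierstrassFactorization h0
    have hfin : Module.Finite ℤ_[p] (Lam p ⧸ Ideal.span {q}) := by
      have := H.isDistinguishedAt.monic.finite_quotient
      exact Module.Finite.equiv H.algEquivQuotient.toLinearEquiv
    have hq' : (Ideal.span {q}).IsPrime := (Ideal.span_singleton_prime hq.ne_zero).mpr hq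
    have hle : Ideal.span {q} ≤ P := by rwa [Ideal.span_singleton_le_iff_mem]
    have hne := Ideal.comap_ne_bot_of_integral_mem (R := ℤ_[p])
      (I := P.map (Ideal.Quotient.mk (Ideal.span {q}))) (x := Ideal.Quotient.mk _ b)
      (by rwa [Ne, Ideal.Quotient.eq_zero_iff_mem, Ideal.mem_span_singleton])
      (Ideal.mem_map_of_mem _ hb) (Algebra.IsIntegral.isIntegral _)
    obtain ⟨z, hz, hz0⟩ := Submodule.exists_mem_ne_zero_of_ne_bot hne
    have hzP : PowerSeries.C z ∈ P := by
      have : Ideal.Quotient.mk (Ideal.span {q}) (PowerSeries.C z)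
        ∈ P.map (Ideal.Quotient.mk (Ideal.span {q})) := hz
      rwa [Ideal.mem_quotient_iff_mem hle] at this
    rw [PadicInt.unitCoeff_spec hz0, map_mul, map_pow, ← natCast_eq_C] at hzP
    rcases hP.mem_or_mem hzP with h' | h'
    · exact absurd (Ideal.eq_top_of_isUnit_mem _ h'
        ((PadicInt.unitCoeff hz0).isUnit.map PowerSeries.C)) hP.ne_top
    · exact hP.mem_of_pow_mem _ h'
  obtain ⟨c, hcP, hpc⟩ : ∃ c ∈ P, ¬ (p : Lam p) ∣ c := by
    by_cases hpq : (p : Lam p) ∣ q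
    · refine ⟨b, hb, fun hpb => hqb ?_⟩
      exact ((prime_natCast.dvd_prime_iff_associated hq).mp hpq).symm.dvd.trans hpb
    · exact ⟨q, hqP, hpq⟩
  obtain ⟨n, hn⟩ := X_pow_mem_span hpc
  rw [maximalIdeal_eq_span, Ideal.span_le]
  rintro f (rfl | rfl)
  · exact key
  · refine hP.mem_of_pow_mem n (Ideal.span_le.mpr ?_ hn)
    rintro f (rfl | rfl)
    exacts [key, hcP]

theorem exists_pow_maximalIdeal_le_span {a b : Lam p} (h : IsRelPrime a b) :
    ∃ k, maximalIdeal (Lam p) ^ k ≤ Ideal.span {a, b} := by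
  refine Ideal.exists_pow_le_of_le_radical_of_fg ?_ (IsNoetherian.noetherian _)
  rw [Ideal.radical_eq_sInf]
  refine le_sInf ?_
  rintro P ⟨hle, hP⟩
  exact maximalIdeal_le_of_isRelPrime (hle (Ideal.subset_span (by simp)))
    (hle (Ideal.subset_span (by simp))) h

/-- A finitely generated module killed by two coprime elements is finite. -/
theorem finite_of_isRelPrime (M : Type*) [AddCommGroup M] [Module (Lam p) M]
    [Module.Finite (Lam p) M] {a b : Lam p} (h : IsRelPrime a b) (ha : ∀ x : M, a • x = 0)
    (hb : ∀ x : M, b • x = 0) : Finite M := by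
  obtain ⟨k, hk⟩ := exists_pow_maximalIdeal_le_span h
  refine finite_of_pow_maximalIdeal (p := p) M k fun c hc x => ?_
  obtain ⟨u, v, rfl⟩ := Ideal.mem_span_pair.mp (hk hc)
  rw [add_smul, mul_smul, mul_smul, ha, hb, smul_zero, smul_zero, add_zero]

/-- Prime avoidance: an ideal that lies in no principal prime ideal contains an element coprime to
a given nonzero element. -/
theorem exists_mem_isRelPrime {a : Lam p} (ha : a ≠ 0) (I : Ideal (Lam p))
    (h : ∀ q : Lam p, Prime q → ∃ y ∈ I, ¬ q ∣ y) : ∃ x ∈ I, IsRelPrime a x := by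
  have hfac : ∀ q ∈ {q | q ∈ UniqueFactorizationMonoid.factors a}, Prime q :=
    fun q hq => UniqueFactorizationMonoid.prime_of_factor q hq
  have hfin : {q | q ∈ UniqueFactorizationMonoid.factors a}.Finite := by
    classical
    exact (UniqueFactorizationMonoid.factors a).toFinset.finite_toSet.subset
      fun q hq => by simpa using hq
  have h1 := (Ideal.subset_union_prime_finite hfin (f := fun q => Ideal.span {q}) 0 0
    (fun q hq _ _ => (Ideal.span_singleton_prime (hfac q hq).ne_zero).mpr (hfac q hq))
    (I := I)).not.mpr (by
      rintro ⟨q, hq, hle⟩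
      obtain ⟨y, hy, hqy⟩ := h q (hfac q hq)
      exact hqy (Ideal.mem_span_singleton.mp (hle hy)))
  obtain ⟨x, hx, hx'⟩ := Set.not_subset.mp h1
  refine ⟨x, hx, (UniqueFactorizationMonoid.isRelPrime_iff_no_prime_factors ha).mpr ?_⟩
  intro d hda hdx hd
  obtain ⟨q, hq, hdq⟩ := UniqueFactorizationMonoid.exists_mem_factors_of_dvd ha hd.irreducible hda
  exact hx' (Set.mem_biUnion hq (Ideal.mem_span_singleton.mpr (hdq.symm.dvd.trans hdx)))

theorem exists_mem_maximalIdeal_isRelPrime {a : Lam p} (ha : a ≠ 0) :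
    ∃ x ∈ maximalIdeal (Lam p), IsRelPrime a x := by
  refine exists_mem_isRelPrime ha _ fun q hq => ?_
  by_contra! h
  have h1 := h _ natCast_mem_maximalIdeal
  have h2 := h _ X_mem_maximalIdeal
  exact hq.not_isUnit (isRelPrime_natCast_X h1 h2)

theorem omegaQuot_succ_mem (n : ℕ) : omegaQuot p (n + 1) n ∈ maximalIdeal (Lam p) := by
  rw [mem_maximalIdeal_iff]
  simp [omegaQuot]

theorem omegaQuot_mem_pow {m n : ℕ} (h : n ≤ m) :
    omegaQuot p m n ∈ maximalIdeal (Lam p) ^ (m - n) := by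
  induction m, h using Nat.le_induction with
  | base => simp
  | succ m h ih =>
    rw [← omegaQuot_mul_omegaQuot p h m.le_succ, Nat.succ_sub h, pow_succ']
    exact Ideal.mul_mem_mul (omegaQuot_succ_mem m) ih

theorem omega_dvd_omega {m n : ℕ} (h : n ≤ m) : omega p n ∣ omega p m :=
  ⟨_, ((mul_comm _ _).trans (omegaQuot_mul_omega p h)).symm⟩

theorem not_natCast_dvd_omega (n : ℕ) : ¬ (p : Lam p) ∣ omega p n := by
  intro h
  have hp : p ^ n ≠ 0 := pow_ne_zero _ (Fact.out : p.Prime).ne_zero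
  have h1 := natCast_dvd_iff.mp h (p ^ n)
  have h2 : omega p n = (((1 + Polynomial.X) ^ p ^ n - 1 : Polynomial ℤ_[p]) : PowerSeries ℤ_[p]) := by
    simp [omega]
  rw [h2, Polynomial.coeff_coe, Polynomial.coeff_sub, Polynomial.coeff_one_add_X_pow,
    Polynomial.coeff_one, if_neg hp, Nat.choose_self, Nat.cast_one, sub_zero] at h1
  exact PadicInt.prime_p.not_isUnit (isUnit_of_dvd_one h1)

/-- `ω_n` is squarefree, in the strong form that complementary divisors are coprime: a common
divisor of `c` and `θ` divides the derivative `p ^ n (1 + T) ^ (p ^ n - 1)` of `c θ = ω_n`. -/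
theorem isRelPrime_of_mul_eq_omega {c θ : Lam p} {n : ℕ} (h : c * θ = omega p n) :
    IsRelPrime c θ := by
  have hc : c ≠ 0 := by
    rintro rfl
    exact omega_ne_zero p n (by rw [← h, zero_mul])
  refine (UniqueFactorizationMonoid.isRelPrime_iff_no_prime_factors hc).mpr ?_
  intro q hqc hqθ hq
  have h1 : q ∣ PowerSeries.derivative ℤ_[p] (omega p n) := by
    rw [← h, Derivation.leibniz]
    exact dvd_add (Dvd.dvd.mul_right hqc _) (Dvd.dvd.mul_right hqθ _)
  have h2 : PowerSeries.derivative ℤ_[p] (omega p n)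
      = (p : Lam p) ^ n * (1 + PowerSeries.X) ^ (p ^ n - 1) := by
    rw [omega, map_sub, Derivation.leibniz_pow]
    simp
  rw [h2] at h1
  have hu : IsUnit ((1 + PowerSeries.X : Lam p) ^ (p ^ n - 1)) :=
    IsUnit.pow _ (IsUnit.of_mul_eq_one _ (one_add_X_mul_one_add_iotaT p))
  rw [hu.dvd_mul_right] at h1
  have h3 := (hq.dvd_prime_iff_associated prime_natCast).mp (hq.dvd_of_dvd_pow h1)
  exact not_natCast_dvd_omega n (h3.symm.dvd.trans (h ▸ hqc.mul_right θ))

/-! ### Compactness of finitely generated modules -/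

section Compactness

open scoped PowerSeries.WithPiTopology

theorem compactSpace_lam : CompactSpace (Lam p) :=
  inferInstanceAs (CompactSpace ((Unit →₀ ℕ) → ℤ_[p]))

/-- Submodules of `Λ ^ s` are images of compact modules `Λ ^ k`. -/
theorem isClosed_of_fg {s : ℕ} (N : Submodule (Lam p) (Fin s → Lam p)) :
    IsClosed (N : Set (Fin s → Lam p)) := by
  have _ := compactSpace_lam (p := p)
  obtain ⟨k, f, hf⟩ := (Submodule.fg_iff_exists_fin_linearMap (Lam p) _).mp (IsNoetherian.noetherian N)
  rw [← hf, LinearMap.coe_range]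
  refine (isCompact_range (?_ : Continuous f)).isClosed
  have : (f : (Fin k → Lam p) → (Fin s → Lam p))
      = fun x => ∑ i, x i • f (fun j => if i = j then 1 else 0) := by
    ext1 x
    exact LinearMap.pi_apply_eq_sum_univ f x
  rw [this]
  refine continuous_pi fun j => ?_
  simp only [Finset.sum_apply, Pi.smul_apply, smul_eq_mul]
  fun_prop

/-- A finitely generated `Λ`-module is complete for every descending sequence of submodules:
cosets of submodules of `Λ ^ s` are compact. -/
theorem exists_forall_sub_mem {X : Type*} [AddCommGroup X] [Module (Lam p) X]
    [Module.Finite (Lam p) X] (N : ℕ → Submodule (Lam p) X) (hN : Antitone N) (z : ℕ → X)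
    (hz : ∀ n, z (n + 1) - z n ∈ N n) : ∃ x, ∀ n, x - z n ∈ N n := by
  have _ := compactSpace_lam (p := p)
  obtain ⟨s, π, hπ⟩ := Module.Finite.exists_fin' (Lam p) X
  have hz' : ∀ n, ∃ w, π w = z n := fun n => hπ (z n)
  choose w hw using hz'
  let S : ℕ → Set (Fin s → Lam p) := fun n => {y | y - w n ∈ (N n).comap π}
  have hS : ∀ n, IsClosed (S n) := fun n =>
    (isClosed_of_fg ((N n).comap π)).preimage (continuous_id.sub continuous_const)
  obtain ⟨y, hy⟩ := IsCompact.nonempty_iInter_of_sequence_nonempty_isCompact_isClosed S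
    (fun n y hy => by
      have h1 : π (y - w (n + 1)) ∈ N n := hN n.le_succ hy
      have h2 := add_mem h1 (hz n)
      rw [← hw, ← hw, ← map_sub, ← map_add] at h2
      simpa [S] using h2)
    (fun n => ⟨w n, by simp [S]⟩) (hS 0).isCompact hS
  refine ⟨π y, fun n => ?_⟩
  have := Set.mem_iInter.mp hy n
  rw [← hw, ← map_sub]
  exact this

end Compactness

/-! ### The functors in terms of elements -/

section Elements

variable (p) (X : Type*) [AddCommGroup X] [Module (Lam p) X]

/-- The discrete module `lim_→ (X / ω_n X)[p^∞]` whose dual is `𝔉(X)`. It is a separate definition so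
that it carries a single group structure, the one of `Module.DirectLimit` as a group, which the dual
refers to. -/
def DirLim : Type _ := Module.DirectLimit (level p X) (normMap p X)

instance : AddCommGroup (DirLim p X) :=
  inferInstanceAs (AddCommGroup (Module.DirectLimit (level p X) (normMap p X)))

instance : Module (Lam p) (DirLim p X) :=
  Module.DirectLimit.module (level p X) (normMap p X)

/-- The submodule of `X` of those `x` whose class in `X / ω_n X` is `p`-power torsion. -/
def preTorsion (n : ℕ) : Submodule (Lam p) X :=
  (pPrimary p (X ⧸ omegaSub p X n)).comap (omegaSub p X n).mkQ

/-- The submodule `⋂ n, {x | x is p-power torsion modulo ω_n X}` of `X`. For finitely generated `X`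
it is `𝔊(X)`, see `coreEquiv`. -/
def core : Submodule (Lam p) X := ⨅ n, preTorsion p X n

variable {p X}

theorem mem_preTorsion {n : ℕ} {x : X} :
    x ∈ preTorsion p X n ↔ ∃ (k : ℕ) (y : X), (p : Lam p) ^ k • x = omega p n • y := by
  constructor
  · rintro ⟨⟨_, k, rfl⟩, h⟩
    have h1 : Submodule.Quotient.mk ((p : Lam p) ^ k • x) = (0 : X ⧸ omegaSub p X n) := h
    obtain ⟨y, hy⟩ := (Submodule.Quotient.mk_eq_zero _).mp h1
    exact ⟨k, y, hy.symm⟩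
  · rintro ⟨k, y, h⟩
    refine ⟨⟨_, k, rfl⟩, ?_⟩
    change Submodule.Quotient.mk ((p : Lam p) ^ k • x) = (0 : X ⧸ omegaSub p X n)
    exact (Submodule.Quotient.mk_eq_zero _).mpr ⟨y, h.symm⟩

theorem preTorsion_antitone : Antitone (preTorsion p X) := by
  intro n m h x hx
  obtain ⟨k, y, hy⟩ := mem_preTorsion.mp hx
  exact mem_preTorsion.mpr ⟨k, omegaQuot p m n • y, by
    rw [hy, smul_smul, mul_comm, omegaQuot_mul_omega p h]⟩

theorem omegaQuot_smul_mem {n m : ℕ} (h : n ≤ m) {x : X} (hx : x ∈ preTorsion p X n) :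
    omegaQuot p m n • x ∈ preTorsion p X m := by
  obtain ⟨k, y, hy⟩ := mem_preTorsion.mp hx
  exact mem_preTorsion.mpr ⟨k, y, by
    rw [smul_comm, hy, smul_smul, omegaQuot_mul_omega p h]⟩

variable (p X) in
/-- The class in the direct limit of an element of `X` that is `p`-power torsion modulo `ω_n X`. -/
def toDirLim (n : ℕ) : preTorsion p X n →ₗ[Lam p] DirLim p X :=
  let u := (Module.DirectLimit.of (Lam p) ℕ (level p X) (normMap p X) n).comp
    ((omegaSub p X n).mkQ.restrict (fun _ hx => hx))
  { toFun := u
    map_add' := u.map_add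
    map_smul' := u.map_smul }

theorem exists_toDirLim (z : DirLim p X) : ∃ n x, toDirLim p X n x = z := by
  obtain ⟨n, ⟨y, hy⟩, rfl⟩ := Module.DirectLimit.exists_of
    (show Module.DirectLimit (level p X) (normMap p X) from z)
  obtain ⟨x, rfl⟩ := Submodule.Quotient.mk_surjective _ y
  exact ⟨n, ⟨x, hy⟩, rfl⟩

theorem toDirLim_omegaQuot_smul {n m : ℕ} (h : n ≤ m) (x : preTorsion p X n) :
    toDirLim p X m ⟨omegaQuot p m n • (x : X), omegaQuot_smul_mem h x.2⟩ = toDirLim p X n x :=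
  Module.DirectLimit.of_f (R := Lam p) (ι := ℕ) (G := level p X) (f := normMap p X) (hij := h)
    (x := (⟨Submodule.Quotient.mk (x : X), x.2⟩ : level p X n))

theorem toDirLim_eq_zero_iff {n : ℕ} (x : preTorsion p X n) :
    toDirLim p X n x = 0 ↔ ∃ m, n ≤ m ∧ ∃ y : X, omegaQuot p m n • (x : X) = omega p m • y := by
  constructor
  · intro h
    obtain ⟨m, hm, h1⟩ := Module.DirectLimit.of.zero_exact (R := Lam p) (ι := ℕ)
      (G := level p X) (f := normMap p X)
      (x := (⟨Submodule.Quotient.mk (x : X), x.2⟩ : level p X n)) h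
    have h2 : Submodule.Quotient.mk (omegaQuot p m n • (x : X)) = (0 : X ⧸ omegaSub p X m) :=
      congrArg Subtype.val h1
    obtain ⟨y, hy⟩ := (Submodule.Quotient.mk_eq_zero _).mp h2
    exact ⟨m, hm, y, hy.symm⟩
  · rintro ⟨m, hm, y, hy⟩
    rw [← toDirLim_omegaQuot_smul hm]
    have h2 : Submodule.Quotient.mk (omegaQuot p m n • (x : X)) = (0 : X ⧸ omegaSub p X m) :=
      (Submodule.Quotient.mk_eq_zero _).mpr ⟨y, hy.symm⟩
    have h3 : (⟨_, omegaQuot_smul_mem hm x.2⟩ : level p X m) = 0 := Subtype.ext h2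
    exact (congrArg (Module.DirectLimit.of (Lam p) ℕ (level p X) (normMap p X) m) h3).trans
      (map_zero _)

/-- Krull's intersection theorem. -/
theorem eq_zero_of_forall_pow_maximalIdeal [Module.Finite (Lam p) X] {x : X}
    (h : ∀ n, ∃ a ∈ maximalIdeal (Lam p) ^ n, ∃ y : X, x = a • y) : x = 0 := by
  have h1 := Ideal.iInf_pow_smul_eq_bot_of_isLocalRing (M := X) (maximalIdeal (Lam p))
    (IsLocalRing.maximalIdeal.isMaximal _).ne_top
  rw [← Submodule.mem_bot (Lam p), ← h1, Submodule.mem_iInf]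
  intro n
  obtain ⟨a, ha, y, rfl⟩ := h n
  exact Submodule.smul_mem_smul ha trivial

/-- `⋂ n, ω_n X = 0`, since `ω_n` lies in the `n`-th power of the maximal ideal. -/
theorem eq_zero_of_forall_omega [Module.Finite (Lam p) X] {x : X}
    (h : ∀ n, ∃ y : X, x = omega p n • y) : x = 0 := by
  refine eq_zero_of_forall_pow_maximalIdeal (p := p) fun n => ?_
  refine ⟨omega p n, ?_, h n⟩
  rw [← omegaQuot_mul_omega p n.zero_le]
  exact Ideal.mul_mem_right _ _ (omegaQuot_mem_pow n.zero_le)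

variable (p X) in
/-- For finitely generated `X`, which is complete, `𝔊(X)` is a submodule of `X`. -/
def coreEquiv [Module.Finite (Lam p) X] : core p X ≃ₗ[Lam p] G p X :=
  LinearEquiv.ofBijective
    { toFun := fun x => ⟨fun n => ⟨Submodule.Quotient.mk (x : X), (Submodule.mem_iInf _).mp x.2 n⟩,
        fun _ _ _ => rfl⟩
      map_add' := fun _ _ => rfl
      map_smul' := fun _ _ => rfl } (by
    constructor
    · rw [injective_iff_map_eq_zero]
      intro x hx
      apply Subtype.ext
      refine eq_zero_of_forall_omega (p := p) fun n => ?_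
      have h1 : (Submodule.Quotient.mk (x : X) : X ⧸ omegaSub p X n) = 0 :=
        congrArg (fun z : G p X => ((z : ∀ n, level p X n) n : X ⧸ omegaSub p X n)) hx
      obtain ⟨y, hy⟩ := (Submodule.Quotient.mk_eq_zero _).mp h1
      exact ⟨y, hy.symm⟩
    · rintro ⟨g, hg⟩
      have h1 : ∀ n, ∃ z : X, Submodule.Quotient.mk z = (g n : X ⧸ omegaSub p X n) :=
        fun n => Submodule.Quotient.mk_surjective _ _
      choose z hz using h1
      obtain ⟨x, hx⟩ := exists_forall_sub_mem (fun n => omegaSub p X n) (by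
          rintro n m h _ ⟨y, rfl⟩
          refine ⟨omegaQuot p m n • y, ?_⟩
          simp only [LinearMap.lsmul_apply]
          rw [smul_smul, mul_comm, omegaQuot_mul_omega p h]) z (fun n => by
          have h2 := congrArg Subtype.val (hg n (n + 1) n.le_succ)
          rw [← hz n] at h2
          change projQuot p X n (n + 1) n.le_succ (g (n + 1)) = _ at h2
          rw [← hz (n + 1)] at h2
          exact (Submodule.Quotient.eq _).mp h2)
      have h3 : ∀ n, Submodule.Quotient.mk x = (g n : X ⧸ omegaSub p X n) := fun n => by
        rw [← hz n]
        exact (Submodule.Quotient.eq _).mpr (hx n)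
      refine ⟨⟨x, (Submodule.mem_iInf _).mpr fun n => ?_⟩, ?_⟩
      · change Submodule.Quotient.mk x ∈ pPrimary p _
        rw [h3 n]
        exact (g n).2
      · apply Subtype.ext
        funext n
        exact Subtype.ext (h3 n))

end Elements

/-! ### Homomorphisms to `ℚ_p / ℤ_p` -/

instance : DivisibleBy (QpModZp p) ℤ :=
  Function.Surjective.divisibleBy (QuotientAddGroup.mk' (PadicInt.subring p).toAddSubgroup)
    (QuotientAddGroup.mk'_surjective _) (fun _ _ => rfl)

/-- `ℚ_p / ℤ_p` is an injective abelian group. -/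
theorem exists_extension {A B : Type*} [AddCommGroup A] [AddCommGroup B] (f : A →+ B)
    (hf : Function.Injective f) (φ : A →+ QpModZp p) : ∃ ψ : B →+ QpModZp p, ψ.comp f = φ :=
  (Module.Baer.of_divisible _).extension_property_addMonoidHom f hf φ

theorem nsmul_eq_zero_iff (q : ℕ) (x : ℚ_[p]) :
    q • (QuotientAddGroup.mk x : QpModZp p) = 0 ↔ ∃ z : ℤ_[p], (q : ℚ_[p]) * x = z := by
  rw [← QuotientAddGroup.mk_nsmul, QuotientAddGroup.eq_zero_iff, nsmul_eq_mul]
  exact ⟨fun h => ⟨⟨_, h⟩, rfl⟩, fun ⟨z, hz⟩ => hz ▸ z.2⟩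

/-- The `q`-torsion of `ℚ_p / ℤ_p` is cyclic of order dividing `q`. -/
theorem exists_forall_torsion_eq_nsmul {q : ℕ} (hq : q.Prime) :
    ∃ w₀ : QpModZp p, ∀ w : QpModZp p, q • w = 0 → ∃ a < q, w = a • w₀ := by
  have hp0 : (p : ℚ_[p]) ≠ 0 := by exact_mod_cast (Fact.out : p.Prime).ne_zero
  by_cases hqp : q = p
  · subst hqp
    refine ⟨QuotientAddGroup.mk (q : ℚ_[q])⁻¹, fun w hw => ?_⟩
    obtain ⟨x, rfl⟩ := QuotientAddGroup.mk_surjective w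
    obtain ⟨z, hz⟩ := (nsmul_eq_zero_iff _ _).mp hw
    obtain ⟨a, ha, hza⟩ := PadicInt.exists_mem_range z
    refine ⟨a, ha, ?_⟩
    rw [PadicInt.maximalIdeal_eq_span_p, Ideal.mem_span_singleton] at hza
    obtain ⟨c, hc⟩ := hza
    have hc' : (z : ℚ_[q]) - a = q * c := by
      have := congrArg (fun t : ℤ_[q] => (t : ℚ_[q])) hc
      push_cast at this
      exact this
    rw [← QuotientAddGroup.mk_nsmul, ← sub_eq_zero, ← QuotientAddGroup.mk_sub,
      QuotientAddGroup.eq_zero_iff]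
    have : x - a • (q : ℚ_[q])⁻¹ = c := by
      rw [nsmul_eq_mul]
      field_simp
      rw [mul_comm x, hz, hc']
    rw [this]
    exact c.2
  · refine ⟨0, fun w hw => ⟨0, hq.pos, ?_⟩⟩
    obtain ⟨x, rfl⟩ := QuotientAddGroup.mk_surjective w
    obtain ⟨z, hz⟩ := (nsmul_eq_zero_iff _ _).mp hw
    have hu : IsUnit (q : ℤ_[p]) := by
      rw [PadicInt.isUnit_iff, PadicInt.norm_def, PadicInt.coe_natCast]
      exact (Padic.norm_natCast_eq_one_iff).mpr
        ((Nat.coprime_primes (Fact.out : p.Prime) hq).mpr (Ne.symm hqp))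
    obtain ⟨v, hv⟩ := hu.exists_left_inv
    have hv' : (v : ℚ_[p]) * q = 1 := by
      have := congrArg (fun t : ℤ_[p] => (t : ℚ_[p])) hv
      push_cast at this
      exact this
    refine Eq.trans ?_ (zero_nsmul _).symm
    rw [QuotientAddGroup.eq_zero_iff]
    have : x = (v * z : ℤ_[p]) := by
      rw [PadicInt.coe_mul, ← hz, ← mul_assoc, hv', one_mul]
    rw [this]
    exact (v * z).2

/-- A finite abelian group has at most as many characters with values in `ℚ_p / ℤ_p` as
elements. -/
theorem finite_addMonoidHom_and_card_le (A : Type*) [AddCommGroup A] [Finite A] :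
    Finite (A →+ QpModZp p) ∧ Nat.card (A →+ QpModZp p) ≤ Nat.card A := by
  induction h : Nat.card A using Nat.strong_induction_on generalizing A with
  | _ N ih =>
    rcases subsingleton_or_nontrivial A with hA | hA
    · have : Subsingleton (A →+ QpModZp p) :=
        ⟨fun φ ψ => AddMonoidHom.ext fun a => by rw [Subsingleton.elim a 0, map_zero, map_zero]⟩
      refine ⟨inferInstance, ?_⟩
      rw [← h]
      exact (Finite.card_le_one_iff_subsingleton.mpr this).trans Nat.card_pos
    -- divide by a subgroup `B` of prime order `q`, generated by `a`: the characters that are trivial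
    -- on `a` come from `A / B`, and there are at most `q` values at `a`
    obtain ⟨q, hq, hqN⟩ := Nat.exists_prime_and_dvd (Finite.one_lt_card (α := A)).ne'
    have _ : Fact q.Prime := ⟨hq⟩
    obtain ⟨a, ha⟩ := exists_prime_addOrderOf_dvd_card' q hqN
    let B := AddSubgroup.zmultiples a
    have hB : Nat.card B = q := by rw [Nat.card_zmultiples, ha]
    have hcard : Nat.card A = Nat.card (A ⧸ B) * q := by
      rw [← hB]
      exact AddSubgroup.card_eq_card_quotient_mul_card_addSubgroup B
    have hlt : Nat.card (A ⧸ B) < N := by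
      rw [← h, hcard]
      exact lt_mul_of_one_lt_right Nat.card_pos hq.one_lt
    obtain ⟨hf, hle⟩ := ih _ hlt (A ⧸ B) rfl
    let K : AddSubgroup (A →+ QpModZp p) := (AddMonoidHom.eval a).ker
    let r : K → ((A ⧸ B) →+ QpModZp p) := fun φ =>
      QuotientAddGroup.lift B φ.1 (by
        rw [AddSubgroup.zmultiples_le]
        exact φ.2)
    have hr : Function.Injective r := fun φ ψ hφψ => by
      refine Subtype.ext (AddMonoidHom.ext fun x => ?_)
      exact DFunLike.congr_fun hφψ (QuotientAddGroup.mk x)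
    have hK : Finite K := Finite.of_injective r hr
    have hKle : Nat.card K ≤ Nat.card (A ⧸ B) := (Nat.card_le_card_of_injective r hr).trans hle
    obtain ⟨w₀, hw₀⟩ := exists_forall_torsion_eq_nsmul (p := p) hq
    have hsurj : ∀ φ : A →+ QpModZp p, ∃ n < q, φ a = n • w₀ := fun φ => by
      apply hw₀
      rw [← map_nsmul, ← ha, addOrderOf_nsmul_eq_zero, map_zero]
    choose n hn hφ using hsurj
    let s : (A →+ QpModZp p) ⧸ K → Fin q := fun x => ⟨n x.out, hn _⟩
    have hs : Function.Injective s := fun x y hxy => by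
      have h1 : n x.out = n y.out := congrArg Fin.val hxy
      rw [← QuotientAddGroup.out_eq' x, ← QuotientAddGroup.out_eq' y, QuotientAddGroup.eq]
      change (-x.out + y.out) a = 0
      rw [AddMonoidHom.add_apply, AddMonoidHom.neg_apply, hφ, hφ, h1, neg_add_cancel]
    have hQ : Finite ((A →+ QpModZp p) ⧸ K) := Finite.of_injective s hs
    have hfin : Finite (A →+ QpModZp p) :=
      Finite.of_equiv _ (AddSubgroup.addGroupEquivQuotientProdAddSubgroup (s := K)).symm
    refine ⟨hfin, ?_⟩
    rw [← h, hcard, AddSubgroup.card_eq_card_quotient_mul_card_addSubgroup K, mul_comm]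
    refine Nat.mul_le_mul hKle ?_
    simpa using Nat.card_le_card_of_injective s hs

/-! ### Pseudo-isomorphisms and the functors -/

section Functoriality

variable {X Y Z : Type*} [AddCommGroup X] [Module (Lam p) X] [AddCommGroup Y] [Module (Lam p) Y]
  [AddCommGroup Z] [Module (Lam p) Z]

theorem map_mem_preTorsion (u : X →ₗ[Lam p] Y) {n : ℕ} {x : X} (hx : x ∈ preTorsion p X n) :
    u x ∈ preTorsion p Y n := by
  obtain ⟨k, y, hy⟩ := mem_preTorsion.mp hx
  exact mem_preTorsion.mpr ⟨k, u y, by rw [← map_smul, hy, map_smul]⟩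

/-- The map `(X / ω_n X)[p^∞] → (Y / ω_n Y)[p^∞]` induced by a linear map. -/
def levelMap (u : X →ₗ[Lam p] Y) (n : ℕ) : level p X n →ₗ[Lam p] level p Y n :=
  ((omegaSub p X n).mapQ (omegaSub p Y n) u (by
    rintro _ ⟨x, rfl⟩
    exact ⟨u x, (map_smul u _ _).symm⟩)).restrict (map_pPrimary p _)

theorem levelMap_comp_normMap (u : X →ₗ[Lam p] Y) (n m : ℕ) (h : n ≤ m) :
    levelMap u m ∘ₗ normMap p X n m h = normMap p Y n m h ∘ₗ levelMap u n := by
  ext ⟨x, hx⟩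
  obtain ⟨x, rfl⟩ := Submodule.Quotient.mk_surjective _ x
  exact congrArg Submodule.Quotient.mk (map_smul u _ _)

/-- The map of direct limits induced by a linear map. -/
def dirLimMap (u : X →ₗ[Lam p] Y) : DirLim p X →ₗ[Lam p] DirLim p Y :=
  let v : Module.DirectLimit (level p X) (normMap p X) →ₗ[Lam p]
      Module.DirectLimit (level p Y) (normMap p Y) :=
    Module.DirectLimit.map (levelMap u) (levelMap_comp_normMap u)
  { toFun := v
    map_add' := v.map_add
    map_smul' := v.map_smul }

@[simp]
theorem dirLimMap_toDirLim (u : X →ₗ[Lam p] Y) (n : ℕ) (x : preTorsion p X n) :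
    dirLimMap u (toDirLim p X n x) = toDirLim p Y n ⟨u x, map_mem_preTorsion u x.2⟩ :=
  Module.DirectLimit.map_apply_of (R := Lam p) (ι := ℕ) (G := level p X) (f := normMap p X)
    (G' := level p Y) (f' := normMap p Y) _ (levelMap_comp_normMap u)
    (⟨Submodule.Quotient.mk (x : X), x.2⟩ : level p X n)

theorem dirLimMap_comp (v : Y →ₗ[Lam p] Z) (u : X →ₗ[Lam p] Y) (z : DirLim p X) :
    dirLimMap (v ∘ₗ u) z = dirLimMap v (dirLimMap u z) := by
  obtain ⟨n, x, rfl⟩ := exists_toDirLim z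
  simp

theorem dirLimMap_id (z : DirLim p X) : dirLimMap LinearMap.id z = z := by
  obtain ⟨n, x, rfl⟩ := exists_toDirLim z
  simp

theorem dirLimMap_zero (z : DirLim p X) : dirLimMap (0 : X →ₗ[Lam p] Y) z = 0 := by
  obtain ⟨n, x, rfl⟩ := exists_toDirLim z
  rw [dirLimMap_toDirLim]
  exact map_zero (toDirLim p Y n)

theorem dirLimMap_add (u v : X →ₗ[Lam p] Y) (z : DirLim p X) :
    dirLimMap (u + v) z = dirLimMap u z + dirLimMap v z := by
  obtain ⟨n, x, rfl⟩ := exists_toDirLim z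
  simp only [dirLimMap_toDirLim]
  rw [← map_add]
  rfl

theorem dirLimMap_sum {ι : Type*} (s : Finset ι) (u : ι → X →ₗ[Lam p] Y) (z : DirLim p X) :
    dirLimMap (∑ i ∈ s, u i) z = ∑ i ∈ s, dirLimMap (u i) z := by
  classical
  induction s using Finset.induction_on with
  | empty => simp [dirLimMap_zero]
  | insert i s hi ih => rw [Finset.sum_insert hi, Finset.sum_insert hi, dirLimMap_add, ih]

/-- The map `𝔉(Y) → 𝔉(X)` induced by a linear map `X → Y`. -/
def FMap (u : X →ₗ[Lam p] Y) : F p Y →ₗ[Lam p] F p X where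
  toFun φ := AddMonoidHom.comp (show DirLim p Y →+ QpModZp p from φ) (dirLimMap u).toAddMonoidHom
  map_add' _ _ := rfl
  map_smul' c φ := AddMonoidHom.ext fun z =>
    congrArg (show DirLim p Y →+ QpModZp p from φ) (map_smul (dirLimMap u) (iota p c) z).symm

/-- The data of a pseudo-isomorphism in the form used below: one power of the maximal ideal kills
the kernel and the cokernel. -/
theorem exists_pow_of_finite (u : X →ₗ[Lam p] Y) [Finite (LinearMap.ker u)]
    [Finite (Y ⧸ LinearMap.range u)] : ∃ k : ℕ, ∀ a ∈ maximalIdeal (Lam p) ^ k,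
      (∀ x, u x = 0 → a • x = 0) ∧ ∀ y, ∃ x, u x = a • y := by
  obtain ⟨k, hk⟩ := exists_pow_maximalIdeal_smul (p := p) (LinearMap.ker u)
  obtain ⟨l, hl⟩ := exists_pow_maximalIdeal_smul (p := p) (Y ⧸ LinearMap.range u)
  refine ⟨max k l, fun a ha => ⟨fun x hx => ?_, fun y => ?_⟩⟩
  · exact congrArg Subtype.val (hk a (Ideal.pow_le_pow_right (le_max_left k l) ha) ⟨x, hx⟩)
  · have := hl a (Ideal.pow_le_pow_right (le_max_right k l) ha) (Submodule.Quotient.mk y)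
    exact (Submodule.Quotient.mk_eq_zero _).mp this

/-- A pseudo-isomorphism detects whether an element is `p`-power torsion modulo `ω_n`. -/
theorem mem_preTorsion_of_map (u : X →ₗ[Lam p] Y) [Finite (LinearMap.ker u)]
    [Finite (Y ⧸ LinearMap.range u)] {n : ℕ} {x : X} (hx : u x ∈ preTorsion p Y n) :
    x ∈ preTorsion p X n := by
  obtain ⟨k, hk⟩ := exists_pow_of_finite u
  obtain ⟨h1, h2⟩ := hk _ (Ideal.pow_mem_pow natCast_mem_maximalIdeal k)
  obtain ⟨j, y, hy⟩ := mem_preTorsion.mp hx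
  obtain ⟨x', hx'⟩ := h2 y
  have h3 := h1 ((p : Lam p) ^ (k + j) • x - omega p n • x') (by
    rw [map_sub, map_smul, map_smul, hx', pow_add, mul_smul, hy, smul_comm, sub_self])
  refine mem_preTorsion.mpr ⟨k + (k + j), (p : Lam p) ^ k • x', ?_⟩
  rw [pow_add, mul_smul, smul_comm (omega p n), ← sub_eq_zero, ← smul_sub, h3]

/-- The direct limits do not see finite cokernels: the transition map from level `n` to level
`n + k` is multiplication by an element of the `k`-th power of the maximal ideal, which moves every
element of `Y` into the image of `X` when `k` is large. -/
theorem dirLimMap_surjective (u : X →ₗ[Lam p] Y) [Finite (LinearMap.ker u)]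
    [Finite (Y ⧸ LinearMap.range u)] : Function.Surjective (dirLimMap u) := by
  intro z
  obtain ⟨n, y, rfl⟩ := exists_toDirLim z
  obtain ⟨k, hk⟩ := exists_pow_of_finite u
  have h1 := omegaQuot_mem_pow (p := p) (n.le_add_right k)
  rw [Nat.add_sub_cancel_left] at h1
  obtain ⟨x, hx⟩ := (hk _ h1).2 y
  have hy := omegaQuot_smul_mem (n.le_add_right k) y.2
  have hx' : x ∈ preTorsion p X (n + k) := mem_preTorsion_of_map u (hx ▸ hy)
  refine ⟨toDirLim p X (n + k) ⟨x, hx'⟩, ?_⟩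
  rw [dirLimMap_toDirLim, ← toDirLim_omegaQuot_smul (n.le_add_right k) y]
  exact congrArg _ (Subtype.ext hx)

/-- Two elements of the kernel of the map of direct limits agree as soon as they are represented by
`x, x'` with `u x = ω_n y`, `u x' = ω_n' y'` and `y` congruent to `y'` modulo the image of `u`. -/
theorem toDirLim_eq_of_sub_mem_range (u : X →ₗ[Lam p] Y) [Finite (LinearMap.ker u)]
    [Finite (Y ⧸ LinearMap.range u)] {n n' : ℕ} (x : preTorsion p X n) (x' : preTorsion p X n')
    {y y' : Y} (hx : u x = omega p n • y) (hx' : u x' = omega p n' • y')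
    (h : y - y' ∈ LinearMap.range u) : toDirLim p X n x = toDirLim p X n' x' := by
  wlog hn : n = n' generalizing n n'
  · rw [← toDirLim_omegaQuot_smul (le_max_left n n') x,
      ← toDirLim_omegaQuot_smul (le_max_right n n') x']
    refine this _ _ ?_ ?_ rfl
    · rw [map_smul, hx, smul_smul, omegaQuot_mul_omega p (le_max_left n n')]
    · rw [map_smul, hx', smul_smul, omegaQuot_mul_omega p (le_max_right n n')]
  subst hn
  obtain ⟨x'', hx''⟩ := h
  obtain ⟨k, hk⟩ := exists_pow_of_finite u
  have h1 := omegaQuot_mem_pow (p := p) (n.le_add_right k)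
  rw [Nat.add_sub_cancel_left] at h1
  have h2 := (hk _ h1).1 ((x : X) - x' - omega p n • x'') (by
    rw [map_sub, map_sub, map_smul, hx, hx', hx'', ← smul_sub, sub_self])
  rw [← sub_eq_zero, ← map_sub, toDirLim_eq_zero_iff]
  refine ⟨n + k, n.le_add_right k, x'', ?_⟩
  rw [smul_sub, smul_smul, omegaQuot_mul_omega p (n.le_add_right k), sub_eq_zero] at h2
  exact h2

/-- Sending the class of `x`, where `u x = ω_n y`, to the class of `y` embeds the kernel of the map of
direct limits into the cokernel of `u`. -/
theorem finite_ker_dirLimMap (u : X →ₗ[Lam p] Y) [Finite (LinearMap.ker u)]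
    [Finite (Y ⧸ LinearMap.range u)] : Finite (LinearMap.ker (dirLimMap u)) := by
  have key : ∀ z : LinearMap.ker (dirLimMap u), ∃ (y : Y) (n : ℕ) (x : preTorsion p X n),
      toDirLim p X n x = z ∧ u x = omega p n • y := by
    rintro ⟨z, hz⟩
    obtain ⟨n, x, rfl⟩ := exists_toDirLim z
    rw [LinearMap.mem_ker, dirLimMap_toDirLim, toDirLim_eq_zero_iff] at hz
    obtain ⟨m, hm, y, hy⟩ := hz
    exact ⟨y, m, _, toDirLim_omegaQuot_smul hm x, by rw [← hy, map_smul]⟩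
  choose y n x hx hu using key
  refine Finite.of_injective
    (fun z => (Submodule.Quotient.mk (y z) : Y ⧸ LinearMap.range u)) fun z z' h => ?_
  apply Subtype.ext
  rw [← hx, ← hx]
  exact toDirLim_eq_of_sub_mem_range u _ _ (hu z) (hu z') ((Submodule.Quotient.eq _).mp h)

/-- A pseudo-isomorphism `X → Y` induces an injection `𝔉(Y) → 𝔉(X)`. -/
theorem FMap_injective (u : X →ₗ[Lam p] Y) [Finite (LinearMap.ker u)]
    [Finite (Y ⧸ LinearMap.range u)] : Function.Injective (FMap u) := fun φ ψ h =>
  AddMonoidHom.ext fun z => by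
    obtain ⟨z, rfl⟩ := dirLimMap_surjective u z
    exact DFunLike.congr_fun (F := DirLim p X →+ QpModZp p) h z

/-- The injection `𝔉(Y) → 𝔉(X)` induced by a pseudo-isomorphism has finite cokernel. -/
theorem finite_coker_FMap (u : X →ₗ[Lam p] Y) [Finite (LinearMap.ker u)]
    [Finite (Y ⧸ LinearMap.range u)] : Finite (F p X ⧸ LinearMap.range (FMap u)) := by
  have _ := finite_ker_dirLimMap u
  have _ := (finite_addMonoidHom_and_card_le (p := p) (LinearMap.ker (dirLimMap u))).1
  let r : F p X → (LinearMap.ker (dirLimMap u) →+ QpModZp p) := fun φ =>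
    (show DirLim p X →+ QpModZp p from φ).comp
      (LinearMap.ker (dirLimMap u)).subtype.toAddMonoidHom
  refine Finite.of_injective (fun x : F p X ⧸ LinearMap.range (FMap u) => r x.out) ?_
  intro x y hxy
  rw [← Submodule.Quotient.mk_out x, ← Submodule.Quotient.mk_out y, Submodule.Quotient.eq]
  -- characters of the limit of `X` with the same restriction to the kernel differ by one that factors
  -- through the limit of `Y`
  let φ : DirLim p X →+ QpModZp p :=
    (show DirLim p X →+ QpModZp p from x.out) - (show DirLim p X →+ QpModZp p from y.out)
  have hφ : ∀ z, dirLimMap u z = 0 → φ z = 0 := fun z hz => by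
    have := DFunLike.congr_fun hxy ⟨z, hz⟩
    exact sub_eq_zero.mpr this
  have hφ' : (dirLimMap u).toAddMonoidHom.ker ≤ φ.ker := fun z hz => hφ z hz
  exact ⟨(dirLimMap u).toAddMonoidHom.liftOfSurjective (dirLimMap_surjective u) ⟨φ, hφ'⟩,
    AddMonoidHom.ext fun z => AddMonoidHom.liftOfRightInverse_comp_apply
      (dirLimMap u).toAddMonoidHom _ (Function.rightInverse_surjInv (dirLimMap_surjective u))
      ⟨φ, hφ'⟩ z⟩

/-- The map `𝔊(X) → 𝔊(Y)` induced by a linear map, in terms of `core`. -/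
def coreMap (u : X →ₗ[Lam p] Y) : core p X →ₗ[Lam p] core p Y :=
  u.restrict fun _ hx => (Submodule.mem_iInf _).mpr fun n =>
    map_mem_preTorsion u ((Submodule.mem_iInf _).mp hx n)

/-- The kernel and the cokernel of `𝔊(X) → 𝔊(Y)` embed into those of `X → Y`. -/
theorem hasPseudoIso_core (u : X →ₗ[Lam p] Y) [Finite (LinearMap.ker u)]
    [Finite (Y ⧸ LinearMap.range u)] : HasPseudoIso p (core p X) (core p Y) := by
  refine ⟨coreMap u, ?_, ?_⟩
  · refine Finite.of_injective (fun x : LinearMap.ker (coreMap u) =>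
      (⟨x.1, congrArg Subtype.val x.2⟩ : LinearMap.ker u)) fun x y h => ?_
    exact Subtype.ext (Subtype.ext (congrArg (fun z : LinearMap.ker u => (z : X)) h))
  · let w : (core p Y ⧸ LinearMap.range (coreMap u)) →ₗ[Lam p] (Y ⧸ LinearMap.range u) :=
      Submodule.mapQ _ _ (core p Y).subtype (by
        rintro _ ⟨x, rfl⟩
        exact ⟨x, rfl⟩)
    refine Finite.of_injective w ?_
    rw [injective_iff_map_eq_zero]
    intro y hy
    obtain ⟨⟨y, hyc⟩, rfl⟩ := Submodule.Quotient.mk_surjective _ y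
    obtain ⟨x, hx⟩ := (Submodule.Quotient.mk_eq_zero _).mp hy
    change u x = y at hx
    subst hx
    refine (Submodule.Quotient.mk_eq_zero _).mpr ⟨⟨x, ?_⟩, rfl⟩
    exact (Submodule.mem_iInf _).mpr fun n =>
      mem_preTorsion_of_map u ((Submodule.mem_iInf _).mp hyc n)

end Functoriality

/-! ### Socles of complete intersections -/

/-- The socle of `Λ / I` is zero or simple: each element of it is a multiple of each nonzero
element of it. The elements are represented by elements of `Λ`. -/
def SimpleSocle (I : Ideal (Lam p)) : Prop :=
  ∀ x y : Lam p, (∀ a ∈ maximalIdeal (Lam p), a * x ∈ I) → (∀ a ∈ maximalIdeal (Lam p), a * y ∈ I) →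
    x ∉ I → ∃ c, y - c * x ∈ I

theorem mem_span_pair_iff_dvd {f θ x : Lam p} :
    x ∈ Ideal.span {f, θ} ↔ ∃ b, f ∣ x - θ * b := by
  rw [Ideal.mem_span_pair]
  constructor
  · rintro ⟨a, b, rfl⟩
    exact ⟨b, a, by ring⟩
  · rintro ⟨b, a, h⟩
    exact ⟨a, b, by linear_combination -h⟩

/-- The socle of `Λ / (f, θ)` does not depend on the element `θ` coprime to `f`: relations
`θ x' ≡ θ' x` modulo `f` match the socle elements `x` of `Λ / (f, θ)` and `x'` of `Λ / (f, θ')`. -/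
theorem SimpleSocle.exchange {f θ θ' : Lam p} (h : SimpleSocle (Ideal.span {f, θ}))
    (hθ : θ ∈ maximalIdeal (Lam p)) (h1 : IsRelPrime f θ) (h2 : IsRelPrime f θ') :
    SimpleSocle (Ideal.span {f, θ'}) := by
  have key : ∀ x', (∀ a ∈ maximalIdeal (Lam p), a * x' ∈ Ideal.span {f, θ'}) →
      ∃ x, f ∣ θ * x' - θ' * x ∧ ∀ a ∈ maximalIdeal (Lam p), a * x ∈ Ideal.span {f, θ} := by
    intro x' hx'
    obtain ⟨x, hx⟩ := mem_span_pair_iff_dvd.mp (hx' θ hθ)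
    refine ⟨x, hx, fun a ha => ?_⟩
    obtain ⟨b, hb⟩ := mem_span_pair_iff_dvd.mp (hx' a ha)
    refine mem_span_pair_iff_dvd.mpr ⟨b, h2.dvd_of_dvd_mul_left ?_⟩
    have h3 := dvd_sub (hb.mul_left θ) (hx.mul_left a)
    exact h3.trans (dvd_of_eq (by ring))
  intro x' y' hx' hy' hxn
  obtain ⟨x, hx, hmx⟩ := key x' hx'
  obtain ⟨y, hy, hmy⟩ := key y' hy'
  have hxn' : x ∉ Ideal.span {f, θ} := fun hxm => by
    obtain ⟨b, hb⟩ := mem_span_pair_iff_dvd.mp hxm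
    refine hxn (mem_span_pair_iff_dvd.mpr ⟨b, h1.dvd_of_dvd_mul_left ?_⟩)
    exact (dvd_add hx (hb.mul_left θ')).trans (dvd_of_eq (by ring))
  obtain ⟨c, hc⟩ := h x y hmx hmy hxn'
  obtain ⟨b, hb⟩ := mem_span_pair_iff_dvd.mp hc
  refine ⟨c, mem_span_pair_iff_dvd.mpr ⟨b, h1.dvd_of_dvd_mul_left ?_⟩⟩
  exact (dvd_add (dvd_sub hy (hx.mul_left c)) (hb.mul_left θ')).trans (dvd_of_eq (by ring))

theorem simpleSocle_maximalIdeal : SimpleSocle (maximalIdeal (Lam p)) := by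
  intro x y _ _ hx
  rw [mem_maximalIdeal, mem_nonunits_iff, not_not] at hx
  obtain ⟨v, hv⟩ := hx.exists_left_inv
  refine ⟨y * v, ?_⟩
  rw [mul_assoc, hv, mul_one, sub_self]
  exact zero_mem _

/-- For coprime `f` and `θ` the finite ring `Λ / (f, θ)` is Gorenstein. With `x` in the maximal ideal
and coprime to `f` and `p`, one exchanges generators from `(p, T)`, where it holds since the quotient
is a field, to `(p, x)`, `(f, x)` and `(f, θ)`. -/
theorem simpleSocle_span_pair {f θ : Lam p} (hf : f ≠ 0) (h : IsRelPrime f θ) :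
    SimpleSocle (Ideal.span {f, θ}) := by
  obtain ⟨x, hx, hfx⟩ := exists_mem_maximalIdeal_isRelPrime
    (mul_ne_zero hf (prime_natCast (p := p)).ne_zero)
  have h0 : SimpleSocle (Ideal.span {(p : Lam p), PowerSeries.X}) := by
    rw [← maximalIdeal_eq_span]
    exact simpleSocle_maximalIdeal
  have h1 := h0.exchange X_mem_maximalIdeal isRelPrime_natCast_X (hfx.of_mul_left_right)
  rw [Set.pair_comm] at h1
  have h2 := h1.exchange natCast_mem_maximalIdeal (hfx.of_mul_left_right).symm
    (hfx.of_mul_left_left).symm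
  rw [Set.pair_comm] at h2
  exact h2.exchange hx hfx.of_mul_left_left h

/-! ### Duality for a union of Gorenstein rings -/

/-- An element of order `p` is detected by a character with values in `ℚ_p / ℤ_p`. -/
theorem exists_character_ne_zero {D : Type*} [AddCommGroup D] {s : D} (hs : s ≠ 0)
    (hps : p • s = 0) : ∃ φ : D →+ QpModZp p, φ s ≠ 0 := by
  have hp0 : (p : ℚ_[p]) ≠ 0 := by exact_mod_cast (Fact.out : p.Prime).ne_zero
  have hw : p • (QuotientAddGroup.mk (p : ℚ_[p])⁻¹ : QpModZp p) = 0 :=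
    (nsmul_eq_zero_iff _ _).mpr ⟨1, by rw [mul_inv_cancel₀ hp0, PadicInt.coe_one]⟩
  let i : ZMod p →+ D := ZMod.lift p ⟨zmultiplesHom D s, by simpa using hps⟩
  let j : ZMod p →+ QpModZp p := ZMod.lift p ⟨zmultiplesHom _ _, by simpa using hw⟩
  have hi1 : i 1 = s := by
    have := ZMod.lift_coe p ⟨zmultiplesHom D s, by simpa using hps⟩ 1
    simpa using this
  have hj1 : j 1 = QuotientAddGroup.mk (p : ℚ_[p])⁻¹ := by
    have := ZMod.lift_coe p ⟨zmultiplesHom _ _, by simpa using hw⟩ 1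
    simpa using this
  have hi : Function.Injective i := by
    rw [injective_iff_map_eq_zero]
    intro a ha
    by_contra ha0
    apply hs
    have h1 : i (a.val • (a⁻¹ * 1)) = s := by
      rw [nsmul_eq_mul, ZMod.natCast_val, ZMod.cast_id', id, mul_one, mul_inv_cancel₀ ha0, hi1]
    rw [← h1, mul_one, nsmul_eq_mul, mul_comm, ZMod.natCast_val, ZMod.cast_id', id]
    have h2 : a⁻¹ * a = a⁻¹.val • a := by
      rw [nsmul_eq_mul, ZMod.natCast_val, ZMod.cast_id', id]
    rw [h2, map_nsmul, ha, smul_zero]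
  obtain ⟨φ, hφ⟩ := exists_extension i hi j
  refine ⟨φ, ?_⟩
  rw [← hi1, ← AddMonoidHom.comp_apply, hφ, hj1, Ne, QuotientAddGroup.eq_zero_iff]
  intro h
  have h1 : ‖(p : ℚ_[p])⁻¹‖ ≤ 1 := h
  rw [norm_inv, Padic.norm_p, inv_inv] at h1
  exact absurd h1 (not_le.mpr (by exact_mod_cast (Fact.out : p.Prime).one_lt))

section Duality

variable {D : Type*} [AddCommGroup D] [Module (Lam p) D] {I : ℕ → Ideal (Lam p)}
  {τ : ℕ → Lam p →ₗ[Lam p] D}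

/-- Let `D` be the increasing union of the images of `Λ / I_n`, finite rings with simple socles.
A character of `D` that does not vanish on the socle of `D` vanishes on no nonzero submodule. -/
theorem exists_character_faithful (hker : ∀ n, LinearMap.ker (τ n) = I n)
    (hmono : ∀ n, LinearMap.range (τ n) ≤ LinearMap.range (τ (n + 1)))
    (hsurj : ∀ z, ∃ n x, τ n x = z) (hfin : ∀ n, Finite (Lam p ⧸ I n))
    (hsoc : ∀ n, SimpleSocle (I n)) :
    ∃ φ : D →+ QpModZp p, ∀ z, (∀ c : Lam p, φ (c • z) = 0) → z = 0 := by
  have hmono' : Monotone fun n => LinearMap.range (τ n) := monotone_nat_of_le_succ hmono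
  -- every nonzero submodule meets the socle of `D`
  have hsocle : ∀ z : D, z ≠ 0 → ∃ c : Lam p, c • z ≠ 0 ∧
      ∀ a ∈ maximalIdeal (Lam p), a • c • z = 0 := by
    intro z hz
    obtain ⟨n, x, rfl⟩ := hsurj z
    have hfin1 : Finite (LinearMap.range (τ n)) := by
      have := hfin n
      rw [← hker n] at this
      exact Finite.of_equiv _ (τ n).quotKerEquivRange.toEquiv
    obtain ⟨k, hk⟩ := exists_pow_maximalIdeal_smul (p := p) (LinearMap.range (τ n))
    have hex : ∃ k : ℕ, ∀ a ∈ maximalIdeal (Lam p) ^ k, a • τ n x = 0 :=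
      ⟨k, fun a ha => congrArg Subtype.val (hk a ha ⟨τ n x, x, rfl⟩)⟩
    classical
    obtain ⟨j, hj⟩ : ∃ j, Nat.find hex = j + 1 := by
      refine Nat.exists_eq_succ_of_ne_zero fun h0 => hz ?_
      have := Nat.find_spec hex 1
      rw [h0, pow_zero, Ideal.one_eq_top, one_smul] at this
      exact this trivial
    have hlt := Nat.find_min hex (m := j) (by omega)
    push Not at hlt
    obtain ⟨c, hc, hcz⟩ := hlt
    refine ⟨c, hcz, fun a ha => ?_⟩
    rw [smul_smul]
    refine Nat.find_spec hex _ ?_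
    rw [hj, pow_succ']
    exact Ideal.mul_mem_mul ha hc
  by_cases hD : ∀ z : D, z = 0
  · exact ⟨0, fun z _ => hD z⟩
  push Not at hD
  obtain ⟨z₀, hz₀⟩ := hD
  obtain ⟨c₀, hs0, hs⟩ := hsocle z₀ hz₀
  set s := c₀ • z₀
  obtain ⟨φ, hφ⟩ := exists_character_ne_zero (p := p) hs0 (by
    rw [← Nat.cast_smul_eq_nsmul (Lam p)]
    exact hs _ natCast_mem_maximalIdeal)
  refine ⟨φ, fun z hz => ?_⟩
  by_contra hz0
  obtain ⟨c, hs0', hs'⟩ := hsocle z hz0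
  obtain ⟨n, x, hx⟩ := hsurj s
  obtain ⟨n', x', hx'⟩ := hsurj (c • z)
  obtain ⟨y, hy⟩ : s ∈ LinearMap.range (τ (max n n')) := hmono' (le_max_left n n') ⟨x, hx⟩
  obtain ⟨y', hy'⟩ : c • z ∈ LinearMap.range (τ (max n n')) := hmono' (le_max_right n n') ⟨x', hx'⟩
  -- a socle element of the submodule generated by `z` has `s` as a multiple
  obtain ⟨e, he⟩ := hsoc (max n n') y' y
    (fun a ha => by
      rw [← hker, LinearMap.mem_ker, ← smul_eq_mul, map_smul, hy']
      exact hs' a ha)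
    (fun a ha => by
      rw [← hker, LinearMap.mem_ker, ← smul_eq_mul, map_smul, hy]
      exact hs a ha)
    (fun h => hs0' (by rwa [← hker, LinearMap.mem_ker, hy'] at h))
  rw [← hker, LinearMap.mem_ker, map_sub, ← smul_eq_mul, map_smul, hy, hy', sub_eq_zero] at he
  apply hφ
  rw [he, smul_smul]
  exact hz _

/-- In the situation of `exists_character_faithful`, the dual of `D` is generated by one character,
which has annihilator `⋂ n, I_n`. On `Λ / I_n` every character is a multiple of the given one
because there are not more characters than elements, and `Λ` is compact. -/
theorem exists_character_generator {h : Lam p} (hker : ∀ n, LinearMap.ker (τ n) = I n)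
    (hmono : ∀ n, LinearMap.range (τ n) ≤ LinearMap.range (τ (n + 1)))
    (hsurj : ∀ z, ∃ n x, τ n x = z) (hfin : ∀ n, Finite (Lam p ⧸ I n))
    (hsoc : ∀ n, SimpleSocle (I n)) (hI : Antitone I) (hcap : ∀ a, (∀ n, a ∈ I n) ↔ h ∣ a) :
    ∃ φ : D →+ QpModZp p, (∀ a : Lam p, (∀ z, φ (a • z) = 0) ↔ h ∣ a) ∧
      ∀ ψ : D →+ QpModZp p, ∃ a : Lam p, ∀ z, ψ z = φ (a • z) := by
  obtain ⟨φ, hφ⟩ := exists_character_faithful hker hmono hsurj hfin hsoc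
  have hmem : ∀ n a, (∀ x, φ (a • τ n x) = 0) → a ∈ I n := fun n a ha => by
    rw [← hker, LinearMap.mem_ker]
    refine hφ _ fun c => ?_
    rw [← map_smul, smul_eq_mul, mul_comm, ← smul_eq_mul, map_smul]
    exact ha c
  refine ⟨φ, fun a => ⟨fun ha => (hcap a).mp fun n => hmem n a fun x => ha _, fun ha z => ?_⟩,
    fun ψ => ?_⟩
  · obtain ⟨n, x, rfl⟩ := hsurj z
    have h1 := (hcap a).mpr ha n
    rw [← hker, LinearMap.mem_ker] at h1
    rw [← map_smul, smul_eq_mul, mul_comm, ← smul_eq_mul, map_smul, h1, smul_zero, map_zero]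
  · have key : ∀ n, ∃ a : Lam p, ∀ x, ψ (τ n x) = φ (a • τ n x) := by
      intro n
      have hfin1 : Finite (LinearMap.range (τ n)) := by
        have := hfin n
        rw [← hker n] at this
        exact Finite.of_equiv _ (τ n).quotKerEquivRange.toEquiv
      obtain ⟨hfin2, hcard⟩ := finite_addMonoidHom_and_card_le (p := p) (LinearMap.range (τ n))
      have hpre : ∀ z : LinearMap.range (τ n), ∃ a, τ n a = z := fun z => z.2
      choose r hr using hpre
      -- `z = τ n a` goes to the character `φ (a • ·)`; this is injective, hence bijective by counting
      let g : LinearMap.range (τ n) → (LinearMap.range (τ n) →+ QpModZp p) := fun z =>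
        φ.comp (DistribSMul.toAddMonoidHom D (r z)) |>.comp
          (LinearMap.range (τ n)).subtype.toAddMonoidHom
      have hg : Function.Injective g := by
        intro z z' hzz
        have h1 : r z - r z' ∈ I n := hmem n _ fun x => by
          rw [sub_smul, map_sub, sub_eq_zero]
          exact DFunLike.congr_fun hzz ⟨τ n x, x, rfl⟩
        rw [← hker, LinearMap.mem_ker, map_sub, hr, hr, sub_eq_zero] at h1
        exact Subtype.ext h1
      obtain ⟨z, hz⟩ := (hg.bijective_of_nat_card_le hcard).surjective
        (ψ.comp (LinearMap.range (τ n)).subtype.toAddMonoidHom)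
      exact ⟨r z, fun x => (DFunLike.congr_fun hz ⟨τ n x, x, rfl⟩).symm⟩
    choose a ha using key
    obtain ⟨b, hb⟩ := exists_forall_sub_mem I hI a fun n => hmem n _ fun x => by
      obtain ⟨y, hy⟩ := hmono n ⟨x, rfl⟩
      rw [sub_smul, map_sub, ← ha n, ← hy, ← ha (n + 1), sub_self]
    refine ⟨b, fun z => ?_⟩
    obtain ⟨n, x, rfl⟩ := hsurj z
    have h1 := hb n
    rw [← hker, LinearMap.mem_ker] at h1
    rw [ha n, ← sub_eq_zero, ← map_sub, ← sub_smul, ← neg_sub b, ← map_smul, smul_eq_mul, mul_comm,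
      ← smul_eq_mul, map_smul, map_neg, h1, neg_zero, smul_zero, map_zero]

end Duality

/-! ### The involution `ι` -/

theorem iota_apply (f : Lam p) : iota p f = PowerSeries.subst (iotaT p) f := by
  rw [iota, PowerSeries.coe_substAlgHom]

theorem iota_X : iota p PowerSeries.X = iotaT p := by
  rw [iota_apply, PowerSeries.subst_X (hasSubst_iotaT p)]

theorem iota_iotaT : iota p (iotaT p) = PowerSeries.X := by
  have h := congrArg (iota p) (one_add_X_mul_one_add_iotaT p)
  rw [map_mul, map_add, map_add, map_one, iota_X] at h
  have h1 := one_add_X_mul_one_add_iotaT p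
  linear_combination (1 + PowerSeries.X) * h - (1 + iota p (iotaT p)) * h1

@[simp]
theorem iota_iota (f : Lam p) : iota p (iota p f) = f := by
  have h := congrFun (PowerSeries.subst_comp_subst (R := ℤ_[p]) (hasSubst_iotaT p)
    (hasSubst_iotaT p)) f
  rw [Function.comp_apply] at h
  rw [iota_apply, iota_apply]
  refine h.trans ?_
  have h1 : PowerSeries.subst (iotaT p) (iotaT p) = (PowerSeries.X : Lam p) := by
    rw [← iota_apply, iota_iotaT]
  rw [h1]
  exact PowerSeries.X_subst f

theorem iota_dvd_iota {f g : Lam p} : iota p f ∣ iota p g ↔ f ∣ g :=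
  ⟨fun h => by simpa using map_dvd (iota p) h, map_dvd (iota p)⟩

theorem dvd_iota {f g : Lam p} : f ∣ iota p g ↔ iota p f ∣ g := by
  rw [← iota_dvd_iota, iota_iota]

theorem iota_ne_zero {f : Lam p} (hf : f ≠ 0) : iota p f ≠ 0 := fun h => hf (by
  rw [← iota_iota f, h, map_zero])

/-! ### Cyclic modules -/

/-- A cyclic module generated by `m` whose annihilator is `(h)` is `Λ / h`. -/
theorem nonempty_cyc_equiv {M : Type*} [AddCommGroup M] [Module (Lam p) M] {h : Lam p} (m : M)
    (hker : ∀ a : Lam p, a • m = 0 ↔ h ∣ a) (hsurj : ∀ x : M, ∃ a : Lam p, a • m = x) :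
    Nonempty (cyc h ≃ₗ[Lam p] M) := by
  have h1 : Ideal.span {h} = LinearMap.ker (LinearMap.toSpanSingleton (Lam p) M m) := by
    ext a
    rw [Ideal.mem_span_singleton, LinearMap.mem_ker, LinearMap.toSpanSingleton_apply, hker]
  exact ⟨(Submodule.quotEquivOfEq _ _ h1).trans
    ((LinearMap.toSpanSingleton (Lam p) M m).quotKerEquivOfSurjective hsurj)⟩

theorem nonempty_twist_cyc_equiv (h : Lam p) :
    Nonempty (cyc h ≃ₗ[Lam p] Twist p (cyc (iota p h))) := by
  refine nonempty_cyc_equiv (M := Twist p (cyc (iota p h)))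
    (show Twist p (cyc (iota p h)) from Submodule.Quotient.mk (p := Ideal.span {iota p h}) 1)
    (fun a => ?_) (fun x => ?_)
  · change Submodule.Quotient.mk (p := Ideal.span {iota p h}) (iota p a • 1) = 0 ↔ _
    rw [Submodule.Quotient.mk_eq_zero, smul_eq_mul, mul_one, Ideal.mem_span_singleton,
      iota_dvd_iota]
  · obtain ⟨y, hy⟩ := Submodule.Quotient.mk_surjective _ (show cyc (iota p h) from x)
    refine ⟨iota p y, ?_⟩
    change Submodule.Quotient.mk (p := Ideal.span {iota p h}) (iota p (iota p y) • 1) = _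
    rw [iota_iota, smul_eq_mul, mul_one]
    exact hy

/-- The element `h` is coprime to `ω_n / c` for all large `n`. Then the functors take `Λ / (h c)` to
`Λ / ι(h)` and to `Λ / h`. -/
def IsOmegaComplement (c h : Lam p) : Prop :=
  h ≠ 0 ∧ ∃ n₀, ∀ n, n₀ ≤ n → ∃ θ, omega p n = c * θ ∧ IsRelPrime h θ

section Cyclic

variable {c h : Lam p}

theorem cyc_mk_eq_mk_iff {f x y : Lam p} :
    (Submodule.Quotient.mk x : cyc f) = Submodule.Quotient.mk y ↔ f ∣ x - y := by
  rw [Submodule.Quotient.eq, Ideal.mem_span_singleton]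

/-- The `p`-power torsion of `Λ / (h c, ω_n)` is the ideal generated by `c`: a power of `p` lies in
`(h, ω_n / c)`, and `p` is coprime to `ω_n`. -/
theorem mk_mem_preTorsion_cyc_iff {n : ℕ} {θ : Lam p} (hθ : omega p n = c * θ)
    (hhθ : IsRelPrime h θ) (x : Lam p) :
    (Submodule.Quotient.mk x : cyc (h * c)) ∈ preTorsion p (cyc (h * c)) n ↔ c ∣ x := by
  rw [mem_preTorsion]
  constructor
  · rintro ⟨k, y, hy⟩
    obtain ⟨y, rfl⟩ := Submodule.Quotient.mk_surjective _ y
    have h1 := cyc_mk_eq_mk_iff.mp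
      (show (Submodule.Quotient.mk ((p : Lam p) ^ k * x) : cyc (h * c))
        = Submodule.Quotient.mk (omega p n * y) from hy)
    have h2 : c ∣ (p : Lam p) ^ k * x := by
      have h3 : c ∣ omega p n * y := by
        rw [hθ, mul_assoc]
        exact dvd_mul_right _ _
      exact (dvd_iff_dvd_of_dvd_sub ((dvd_mul_left c h).trans h1)).mpr h3
    have h4 : IsRelPrime c ((p : Lam p) ^ k) := by
      refine IsRelPrime.pow_right ((prime_natCast.irreducible.isRelPrime_iff_not_dvd).mpr ?_).symm
      exact fun h5 => not_natCast_dvd_omega n (h5.trans (hθ ▸ dvd_mul_right c θ))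
    exact h4.dvd_of_dvd_mul_left h2
  · rintro ⟨x, rfl⟩
    obtain ⟨k, hk⟩ := exists_pow_maximalIdeal_le_span hhθ
    obtain ⟨a, b, hab⟩ := Ideal.mem_span_pair.mp
      (hk (Ideal.pow_mem_pow natCast_mem_maximalIdeal k))
    refine ⟨k, Submodule.Quotient.mk (b * x), ?_⟩
    change (Submodule.Quotient.mk ((p : Lam p) ^ k * (c * x)) : cyc (h * c))
      = Submodule.Quotient.mk (omega p n * (b * x))
    refine cyc_mk_eq_mk_iff.mpr ⟨a * x, ?_⟩
    rw [← hab, hθ]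
    ring

/-- `𝔊(Λ / (h c)) ≃ Λ / h` when `h` is coprime to `ω_n / c` for large `n`. -/
theorem nonempty_core_cyc_equiv (hc : IsOmegaComplement c h) :
    Nonempty (cyc h ≃ₗ[Lam p] core p (cyc (h * c))) := by
  obtain ⟨hh, n₀, hn⟩ := hc
  have hc0 : c ≠ 0 := by
    rintro rfl
    obtain ⟨θ, hθ, -⟩ := hn n₀ le_rfl
    exact omega_ne_zero p n₀ (by rw [hθ, zero_mul])
  have hmem : ∀ x : Lam p, (Submodule.Quotient.mk x : cyc (h * c)) ∈ core p (cyc (h * c)) ↔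
      c ∣ x := fun x => by
    rw [core, Submodule.mem_iInf]
    constructor
    · intro hx
      obtain ⟨θ, hθ, hθ'⟩ := hn n₀ le_rfl
      exact (mk_mem_preTorsion_cyc_iff hθ hθ' x).mp (hx n₀)
    · intro hx n
      obtain ⟨θ, hθ, hθ'⟩ := hn (max n₀ n) (le_max_left _ _)
      exact preTorsion_antitone (le_max_right n₀ n) ((mk_mem_preTorsion_cyc_iff hθ hθ' x).mpr hx)
  refine nonempty_cyc_equiv ⟨Submodule.Quotient.mk c, (hmem c).mpr dvd_rfl⟩ (fun a => ?_) ?_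
  · rw [Subtype.ext_iff]
    change Submodule.Quotient.mk (a * c) = (0 : cyc (h * c)) ↔ _
    rw [Submodule.Quotient.mk_eq_zero, Ideal.mem_span_singleton, mul_dvd_mul_iff_right hc0]
  · rintro ⟨x, hx⟩
    obtain ⟨x, rfl⟩ := Submodule.Quotient.mk_surjective _ x
    obtain ⟨a, rfl⟩ := (hmem x).mp hx
    exact ⟨a, Subtype.ext (congrArg Submodule.Quotient.mk (mul_comm a c))⟩

/-- `𝔉(Λ / (h c)) ≃ Λ / ι(h)` when `h` is coprime to `ω_n / c` for large `n`. With `ω_n = c θ_n`, level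
`n` of the direct limit is `c Λ / (h c, c θ_n) ≃ Λ / (h, θ_n)`. These rings are Gorenstein, so that
the dual of their union is cyclic, with annihilator `⋂ n, (h, θ_n) = (h)` up to `ι`. -/
theorem nonempty_F_cyc_equiv (hc : IsOmegaComplement c h) :
    Nonempty (cyc (iota p h) ≃ₗ[Lam p] F p (cyc (h * c))) := by
  obtain ⟨hh, n₀, hn⟩ := hc
  have hc0 : c ≠ 0 := by
    rintro rfl
    obtain ⟨θ, hθ, -⟩ := hn n₀ le_rfl
    exact omega_ne_zero p n₀ (by rw [hθ, zero_mul])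
  choose θ hθ hhθ using fun n => hn (n₀ + n) (n₀.le_add_right n)
  have hθle : ∀ {n m : ℕ} (hnm : n ≤ m), θ m = omegaQuot p (n₀ + m) (n₀ + n) * θ n := by
    intro n m hnm
    apply mul_left_cancel₀ hc0
    rw [← hθ, mul_left_comm, ← hθ, omegaQuot_mul_omega p (by omega)]
  let τ : ℕ → Lam p →ₗ[Lam p] DirLim p (cyc (h * c)) := fun n =>
    (toDirLim p (cyc (h * c)) (n₀ + n)).comp
      (((Ideal.span {h * c}).mkQ.comp (LinearMap.lsmul (Lam p) (Lam p) c)).codRestrict _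
        fun x => (mk_mem_preTorsion_cyc_iff (hθ n) (hhθ n) _).mpr (dvd_mul_right c x))
  have hker : ∀ n, LinearMap.ker (τ n) = Ideal.span {h, θ n} := by
    intro n
    ext x
    rw [LinearMap.mem_ker, mem_span_pair_iff_dvd]
    refine (toDirLim_eq_zero_iff _).trans ?_
    constructor
    · rintro ⟨m, hm, y, hy⟩
      obtain ⟨y, rfl⟩ := Submodule.Quotient.mk_surjective _ y
      obtain ⟨m, rfl⟩ : ∃ m', m = n₀ + m' := ⟨m - n₀, by omega⟩
      have h1 := cyc_mk_eq_mk_iff.mp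
        (show (Submodule.Quotient.mk (omegaQuot p (n₀ + m) (n₀ + n) * (c * x)) : cyc (h * c))
          = Submodule.Quotient.mk (omega p (n₀ + m) * y) from hy)
      have h2 : omegaQuot p (n₀ + m) (n₀ + n) * (c * x) - omega p (n₀ + m) * y
          = (omegaQuot p (n₀ + m) (n₀ + n) * (x - θ n * y)) * c := by
        rw [hθ m, hθle (show n ≤ m by omega)]
        ring
      rw [h2, mul_dvd_mul_iff_right hc0] at h1
      refine ⟨y, IsRelPrime.dvd_of_dvd_mul_left ?_ h1⟩
      have h3 := hhθ m
      rw [hθle (show n ≤ m by omega)] at h3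
      exact h3.of_mul_right_left
    · rintro ⟨y, hy⟩
      refine ⟨n₀ + n, le_rfl, Submodule.Quotient.mk y, ?_⟩
      rw [omegaQuot_self, one_smul]
      refine cyc_mk_eq_mk_iff.mpr ?_
      have h2 : c * x - omega p (n₀ + n) * y = (x - θ n * y) * c := by
        rw [hθ n]
        ring
      exact (mul_dvd_mul_right hy c).trans (dvd_of_eq h2.symm)
  have hmono : ∀ n, LinearMap.range (τ n) ≤ LinearMap.range (τ (n + 1)) := by
    rintro n _ ⟨x, rfl⟩
    refine ⟨omegaQuot p (n₀ + (n + 1)) (n₀ + n) * x, ?_⟩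
    refine Eq.trans ?_ (toDirLim_omegaQuot_smul (show n₀ + n ≤ n₀ + (n + 1) by omega) _)
    refine congrArg (toDirLim p (cyc (h * c)) (n₀ + (n + 1))) (Subtype.ext ?_)
    exact congrArg (Submodule.Quotient.mk (p := Ideal.span {h * c})) (mul_left_comm c _ x)
  have hsurj : ∀ z, ∃ n x, τ n x = z := by
    intro z
    obtain ⟨k, x, rfl⟩ := exists_toDirLim z
    have hx := omegaQuot_smul_mem (Nat.le_add_left k n₀) x.2
    rw [← toDirLim_omegaQuot_smul (Nat.le_add_left k n₀) x]
    obtain ⟨y, hy⟩ := Submodule.Quotient.mk_surjective _ (omegaQuot p (n₀ + k) k • (x : cyc (h * c)))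
    have hy' := hx
    rw [← hy, mk_mem_preTorsion_cyc_iff (hθ k) (hhθ k)] at hy'
    obtain ⟨w, rfl⟩ := hy'
    exact ⟨k, w, congrArg (toDirLim p (cyc (h * c)) (n₀ + k)) (Subtype.ext hy)⟩
  have hfin : ∀ n, Finite (Lam p ⧸ Ideal.span {h, θ n}) := fun n => by
    have hz : ∀ a ∈ Ideal.span {h, θ n}, ∀ x : Lam p ⧸ Ideal.span {h, θ n}, a • x = 0 := by
      intro a ha x
      obtain ⟨x, rfl⟩ := Submodule.Quotient.mk_surjective _ x
      exact (Submodule.Quotient.mk_eq_zero _).mpr (Ideal.mul_mem_right x _ ha)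
    exact finite_of_isRelPrime _ (hhθ n) (hz h (Ideal.subset_span (by simp)))
      (hz (θ n) (Ideal.subset_span (by simp)))
  have hI : Antitone fun n => Ideal.span {h, θ n} := by
    intro n m hnm
    refine Ideal.span_le.mpr ?_
    rintro x (rfl | rfl)
    · exact Ideal.subset_span (by simp)
    · rw [SetLike.mem_coe, hθle hnm]
      exact Ideal.mul_mem_left _ _ (Ideal.subset_span (by simp))
  have hcap : ∀ a, (∀ n, a ∈ Ideal.span {h, θ n}) ↔ h ∣ a := by
    intro a
    constructor
    · intro ha
      have h1 : (Submodule.Quotient.mk a : cyc h) = 0 := by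
        refine eq_zero_of_forall_pow_maximalIdeal (p := p) fun n => ?_
        obtain ⟨b, hb⟩ := mem_span_pair_iff_dvd.mp (ha n)
        refine ⟨θ n, ?_, Submodule.Quotient.mk b, cyc_mk_eq_mk_iff.mpr hb⟩
        have h2 := omegaQuot_mem_pow (p := p) (show n₀ + 0 ≤ n₀ + n by omega)
        rw [hθle n.zero_le]
        refine Ideal.mul_mem_right _ _ ?_
        convert! h2 using 2
        omega
      rwa [Submodule.Quotient.mk_eq_zero, Ideal.mem_span_singleton] at h1
    · exact fun ha n => mem_span_pair_iff_dvd.mpr ⟨0, by simpa using ha⟩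
  obtain ⟨φ, hφ, hgen⟩ := exists_character_generator hker hmono hsurj hfin
    (fun n => simpleSocle_span_pair hh (hhθ n)) hI hcap
  refine nonempty_cyc_equiv (M := F p (cyc (h * c))) (show F p (cyc (h * c)) from φ)
    (fun a => ?_) (fun ψ => ?_)
  · rw [← dvd_iota, ← hφ]
    exact ⟨fun h1 z => DFunLike.congr_fun (F := DirLim p (cyc (h * c)) →+ QpModZp p) h1 z,
      fun h1 => AddMonoidHom.ext h1⟩
  · obtain ⟨a, ha⟩ := hgen ψ
    refine ⟨iota p a, AddMonoidHom.ext fun z => ?_⟩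
    change φ (iota p (iota p a) • z) = _
    rw [iota_iota]
    exact (ha z).symm

end Cyclic

/-- A free module contributes nothing to the direct limit, as `Λ / ω_n` is `p`-torsion free. -/
theorem preTorsion_cyc_zero (n : ℕ) {x : cyc (0 : Lam p)} (hx : x ∈ preTorsion p (cyc (0 : Lam p)) n) :
    ∃ y, x = omega p n • y := by
  obtain ⟨k, y, hy⟩ := mem_preTorsion.mp hx
  obtain ⟨x, rfl⟩ := Submodule.Quotient.mk_surjective _ x
  obtain ⟨y, rfl⟩ := Submodule.Quotient.mk_surjective _ y
  have h1 := zero_dvd_iff.mp (cyc_mk_eq_mk_iff.mp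
    (show (Submodule.Quotient.mk ((p : Lam p) ^ k * x) : cyc (0 : Lam p))
      = Submodule.Quotient.mk (omega p n * y) from hy))
  have h2 : IsRelPrime (omega p n) ((p : Lam p) ^ k) :=
    IsRelPrime.pow_right ((prime_natCast.irreducible.isRelPrime_iff_not_dvd).mpr
      (not_natCast_dvd_omega n)).symm
  obtain ⟨z, rfl⟩ := h2.dvd_of_dvd_mul_left ⟨y, sub_eq_zero.mp h1⟩
  exact ⟨Submodule.Quotient.mk z, rfl⟩

/-- A pair `(f, h)` for which `𝔉` and `𝔊` take `Λ / f` to `Λ / ι(h)` and to `Λ / h`: either `f = 0`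
and `h` is a unit, or `f = h c` where `h` is coprime to `ω_n / c` for large `n`. -/
def IsAdjointPair (f h : Lam p) : Prop :=
  (f = 0 ∧ IsUnit h) ∨ ∃ c, f = h * c ∧ IsOmegaComplement c h

theorem IsAdjointPair.ne_zero {f h : Lam p} (H : IsAdjointPair f h) : h ≠ 0 := by
  rcases H with ⟨-, hu⟩ | ⟨c, -, hc⟩
  exacts [hu.ne_zero, hc.1]

theorem subsingleton_cyc {h : Lam p} (hu : IsUnit h) : Subsingleton (cyc h) :=
  Ideal.Quotient.subsingleton_iff.mpr (Ideal.span_singleton_eq_top.mpr hu)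

theorem IsAdjointPair.nonempty_F_equiv {f h : Lam p} (H : IsAdjointPair f h) :
    Nonempty (cyc (iota p h) ≃ₗ[Lam p] F p (cyc f)) := by
  rcases H with ⟨rfl, hu⟩ | ⟨c, rfl, hc⟩
  · have _ := subsingleton_cyc (hu.map (iota p))
    have hD : ∀ z : DirLim p (cyc (0 : Lam p)), z = 0 := fun z => by
      obtain ⟨n, x, rfl⟩ := exists_toDirLim z
      obtain ⟨y, hy⟩ := preTorsion_cyc_zero n x.2
      exact (toDirLim_eq_zero_iff x).mpr ⟨n, le_rfl, y, by rw [omegaQuot_self, one_smul, hy]⟩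
    have hF : ∀ φ : DirLim p (cyc (0 : Lam p)) →+ QpModZp p, φ = 0 := fun φ =>
      AddMonoidHom.ext fun z => by rw [hD z, map_zero, map_zero]
    have _ : Subsingleton (F p (cyc (0 : Lam p))) := ⟨fun φ ψ => (hF φ).trans (hF ψ).symm⟩
    exact ⟨LinearEquiv.ofSubsingleton _ _⟩
  · exact nonempty_F_cyc_equiv hc

theorem IsAdjointPair.nonempty_core_equiv {f h : Lam p} (H : IsAdjointPair f h) :
    Nonempty (cyc h ≃ₗ[Lam p] core p (cyc f)) := by
  rcases H with ⟨rfl, hu⟩ | ⟨c, rfl, hc⟩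
  · have _ := subsingleton_cyc hu
    have h1 : ∀ x : core p (cyc (0 : Lam p)), x = 0 := fun x => Subtype.ext
      (eq_zero_of_forall_omega (p := p) fun n =>
        preTorsion_cyc_zero n ((Submodule.mem_iInf _).mp x.2 n))
    have _ : Subsingleton (core p (cyc (0 : Lam p))) :=
      ⟨fun x y => (h1 x).trans (h1 y).symm⟩
    exact ⟨LinearEquiv.ofSubsingleton _ _⟩
  · exact nonempty_core_cyc_equiv hc

/-! ### Which cyclic modules occur -/

/-- Nothing is lost from an element coprime to all `ω_n`. -/
theorem isAdjointPair_pow_of_isRelPrime {g : Lam p} (hg : g ≠ 0)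
    (h : ∀ n, IsRelPrime g (omega p n)) (l : ℕ) : IsAdjointPair (g ^ l) (g ^ l) :=
  Or.inr ⟨1, (mul_one _).symm, pow_ne_zero _ hg, 0, fun n _ =>
    ⟨omega p n, (one_mul _).symm, (h n).pow_left⟩⟩

/-- One factor is lost from a power of a divisor of some `ω_n`. -/
theorem isAdjointPair_pow_of_dvd {c : Lam p} {n₀ : ℕ} (hc : c ∣ omega p n₀) (e : ℕ) :
    IsAdjointPair (c ^ (e + 1)) (c ^ e) := by
  have hc0 : c ≠ 0 := fun h => omega_ne_zero p n₀ (zero_dvd_iff.mp (h ▸ hc))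
  refine Or.inr ⟨c, pow_succ c e, pow_ne_zero _ hc0, n₀, fun n hn => ?_⟩
  obtain ⟨θ, hθ⟩ := hc.trans (omega_dvd_omega hn)
  exact ⟨θ, hθ, (isRelPrime_of_mul_eq_omega hθ.symm).pow_left⟩

theorem xi_dvd_omega (a : ℕ) : xi p a ∣ omega p a := by
  rw [← prod_xi]
  exact Finset.dvd_prod_of_mem _ (Finset.self_mem_range_succ a)

theorem exists_isAdjointPair_pow {q : Lam p} (hq : Prime q) (e : ℕ) :
    ∃ h, IsAdjointPair (q ^ e) h := by
  by_cases hqω : ∀ n, IsRelPrime q (omega p n)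
  · exact ⟨_, isAdjointPair_pow_of_isRelPrime hq.ne_zero hqω e⟩
  push Not at hqω
  obtain ⟨n, hn⟩ := hqω
  rw [hq.irreducible.isRelPrime_iff_not_dvd, not_not] at hn
  cases e with
  | zero =>
    refine ⟨1, Or.inr ⟨1, by simp, one_ne_zero, 0, fun n _ => ⟨omega p n, ?_, isRelPrime_one_left⟩⟩⟩
    rw [one_mul]
  | succ e => exact ⟨_, isAdjointPair_pow_of_dvd hn e⟩

/-! ### The module of functionals -/

section Functionals

/-- A map into `B` whose values lie in the image of an injection `A → B` factors through `A`. -/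
theorem exists_lift_of_injective {A B X : Type*} [AddCommGroup A] [Module (Lam p) A]
    [AddCommMonoid B] [Module (Lam p) B] [AddCommGroup X] [Module (Lam p) X] (j : A →ₗ[Lam p] B)
    (hj : Function.Injective j) (g : X →ₗ[Lam p] B) (h : ∀ x, ∃ a, j a = g x) :
    ∃ u : X →ₗ[Lam p] A, ∀ x, j (u x) = g x :=
  ⟨(LinearEquiv.ofInjective j hj).symm.toLinearMap ∘ₗ g.codRestrict (LinearMap.range j) h,
    fun x => LinearEquiv.ofInjective_symm_apply (h := hj) (f := j) ⟨g x, h x⟩⟩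

variable {X : Type*} [AddCommGroup X] [Module (Lam p) X]

theorem exists_eq_smul_of_forall_dvd {q : Lam p} (hq : q ≠ 0) (ψ : X →ₗ[Lam p] Lam p)
    (h : ∀ x, q ∣ ψ x) : ∃ ψ' : X →ₗ[Lam p] Lam p, ψ = q • ψ' := by
  obtain ⟨u, hu⟩ := exists_lift_of_injective (LinearMap.lsmul (Lam p) (Lam p) q)
    (fun a b hab => mul_left_cancel₀ hq hab) ψ fun x => by
      obtain ⟨a, ha⟩ := h x
      exact ⟨a, ha.symm⟩
  exact ⟨u, LinearMap.ext fun x => (hu x).symm⟩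

/-- The module `Hom(X, Λ)` is free. It is `T`-torsion free and its quotient by `T` embeds into a
power of `ℤ_p`, hence has a basis over `ℤ_p`, which lifts to a basis over `Λ`. -/
theorem exists_basis_functionals (X : Type*) [AddCommGroup X] [Module (Lam p) X]
    [Module.Finite (Lam p) X] : ∃ (r : ℕ) (φ : Fin r → X →ₗ[Lam p] Lam p),
      (∀ ψ : X →ₗ[Lam p] Lam p, ∃ a : Fin r → Lam p, ψ = ∑ i, a i • φ i) ∧
      ∀ a : Fin r → Lam p, ∑ i, a i • φ i = 0 → a = 0 := by
  obtain ⟨s, π, hπ⟩ := Module.Finite.exists_fin' (Lam p) X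
  let x : Fin s → X := fun j => π (Pi.single j 1)
  have hx : ∀ y, ∃ c : Fin s → Lam p, y = ∑ j, c j • x j := fun y => by
    obtain ⟨c, rfl⟩ := hπ y
    refine ⟨c, ?_⟩
    conv_lhs => rw [pi_eq_sum_univ' c, map_sum]
    simp only [map_smul, x]
  let ev : (X →ₗ[Lam p] Lam p) →ₗ[Lam p] (Fin s → Lam p) :=
    LinearMap.pi fun j => LinearMap.applyₗ (x j)
  have hev : Function.Injective ev := fun ψ ψ' h => LinearMap.ext fun y => by
    obtain ⟨c, rfl⟩ := hx y
    simp only [map_sum, map_smul]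
    exact Finset.sum_congr rfl fun j _ => congrArg _ (congrFun h j)
  have hnoeth : IsNoetherian (Lam p) (X →ₗ[Lam p] Lam p) := isNoetherian_of_injective ev hev
  -- the constant terms of the values on generators; the kernel is `T Hom(X, Λ)`
  let ε : (X →ₗ[Lam p] Lam p) → (Fin s → ℤ_[p]) := fun ψ j =>
    PowerSeries.constantCoeff (ψ (x j))
  have hεadd : ∀ ψ ψ', ε (ψ + ψ') = ε ψ + ε ψ' := fun ψ ψ' => by
    ext j
    simp [ε]
  have hεsmul : ∀ (a : Lam p) ψ, ε (a • ψ) = PowerSeries.constantCoeff a • ε ψ := fun a ψ => by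
    ext j
    simp [ε]
  have hε0 : ε 0 = 0 := by
    ext j
    simp [ε]
  have hεsum : ∀ {k : ℕ} (a : Fin k → Lam p) (φ : Fin k → X →ₗ[Lam p] Lam p),
      ε (∑ i, a i • φ i) = ∑ i, PowerSeries.constantCoeff (a i) • ε (φ i) := by
    intro k a φ
    simp only [← hεsmul]
    exact map_sum (⟨⟨ε, hε0⟩, hεadd⟩ : (X →ₗ[Lam p] Lam p) →+ (Fin s → ℤ_[p])) _ _
  have hεker : ∀ ψ, ε ψ = 0 → ∃ ψ', ψ = (PowerSeries.X : Lam p) • ψ' := fun ψ h =>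
    exists_eq_smul_of_forall_dvd PowerSeries.X_ne_zero ψ fun y => by
      obtain ⟨c, rfl⟩ := hx y
      rw [map_sum]
      refine Finset.dvd_sum fun j _ => ?_
      rw [map_smul]
      exact (PowerSeries.X_dvd_iff.mpr (congrFun h j)).mul_left _
  let N : Submodule ℤ_[p] (Fin s → ℤ_[p]) :=
    { carrier := Set.range ε
      zero_mem' := ⟨0, hε0⟩
      add_mem' := by
        rintro _ _ ⟨ψ, rfl⟩ ⟨ψ', rfl⟩
        exact ⟨ψ + ψ', hεadd _ _⟩
      smul_mem' := by
        rintro c _ ⟨ψ, rfl⟩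
        exact ⟨PowerSeries.C c • ψ, by rw [hεsmul, PowerSeries.constantCoeff_C]⟩ }
  let b := Module.finBasis ℤ_[p] N
  have hb : ∀ i, ∃ φ, ε φ = b i := fun i => (b i).2
  choose φ hφ using hb
  refine ⟨_, φ, ?_, ?_⟩
  · let S := Submodule.span (Lam p) (Set.range φ)
    -- generation by Nakayama's lemma
    have h1 : (⊤ : Submodule (Lam p) (X →ₗ[Lam p] Lam p)) ≤ S := by
      refine Submodule.le_of_le_smul_of_le_jacobson_bot (I := maximalIdeal (Lam p))
        (IsNoetherian.noetherian _) (maximalIdeal_le_jacobson _) ?_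
      intro ψ _
      let c := b.repr ⟨ε ψ, ψ, rfl⟩
      have h2 : ε (ψ + ∑ i, (-PowerSeries.C (c i)) • φ i) = 0 := by
        rw [hεadd, hεsum]
        simp only [map_neg, PowerSeries.constantCoeff_C, hφ, neg_smul, Finset.sum_neg_distrib]
        have h3 := congrArg Subtype.val (b.sum_repr ⟨ε ψ, ψ, rfl⟩)
        simp only [Submodule.coe_sum, Submodule.coe_smul] at h3
        rw [h3, add_neg_cancel]
      obtain ⟨ψ', hψ'⟩ := hεker _ h2
      have h4 : ψ = ∑ i, (PowerSeries.C (c i)) • φ i + (PowerSeries.X : Lam p) • ψ' := by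
        rw [← hψ']
        refine LinearMap.ext fun y => ?_
        simp only [LinearMap.add_apply, LinearMap.sum_apply, LinearMap.smul_apply, smul_eq_mul,
          neg_mul, Finset.sum_neg_distrib]
        ring
      rw [h4]
      refine Submodule.add_mem_sup ?_ (Submodule.smul_mem_smul X_mem_maximalIdeal trivial)
      exact Submodule.sum_mem _ fun i _ => Submodule.smul_mem _ _ (Submodule.subset_span ⟨i, rfl⟩)
    intro ψ
    obtain ⟨a, ha⟩ := (Submodule.mem_span_range_iff_exists_fun (Lam p)).mp (h1 (x := ψ) trivial)
    exact ⟨a, ha.symm⟩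
  · -- the coefficients of a relation are divisible by all powers of `T`
    have key : ∀ n : ℕ, ∀ a : Fin _ → Lam p, ∑ i, a i • φ i = 0 →
        ∀ i, (PowerSeries.X : Lam p) ^ n ∣ a i := by
      intro n
      induction n with
      | zero => intro a _ i; simp
      | succ n ih =>
        intro a ha
        have h1 : ∑ i, PowerSeries.constantCoeff (a i) • b i = 0 := by
          apply Subtype.ext
          simp only [Submodule.coe_sum, Submodule.coe_smul, ← hφ]
          rw [← hεsum, ha, hε0]
          rfl
        have h2 : ∀ i, PowerSeries.X ∣ a i := fun i =>
          PowerSeries.X_dvd_iff.mpr (Fintype.linearIndependent_iff.mp b.linearIndependent _ h1 i)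
        choose a' ha' using h2
        have h3 : ∑ i, a' i • φ i = 0 := by
          refine LinearMap.ext fun y => ?_
          apply mul_left_cancel₀ (PowerSeries.X_ne_zero (R := ℤ_[p]))
          have h4 := LinearMap.congr_fun ha y
          simp only [LinearMap.sum_apply, LinearMap.smul_apply, LinearMap.zero_apply,
            smul_eq_mul] at h4 ⊢
          rw [mul_zero, Finset.mul_sum, ← h4]
          refine Finset.sum_congr rfl fun i _ => ?_
          rw [ha', mul_assoc]
        intro i
        rw [ha' i, pow_succ']
        exact mul_dvd_mul_left _ (ih a' h3 i)
    intro a ha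
    funext i
    refine PowerSeries.ext fun n => ?_
    rw [Pi.zero_apply, map_zero]
    exact PowerSeries.X_pow_dvd_iff.mp (key (n + 1) a ha i) n n.lt_succ_self

/-- If `s` is not in the prime ideal `(q)` and `s C ⊆ q C`, then `C` is killed by an element outside
`(q)`, by the Cayley–Hamilton theorem. -/
theorem exists_annihilator_not_dvd {C : Type*} [AddCommGroup C] [Module (Lam p) C]
    [Module.Finite (Lam p) C] {q s : Lam p} (hq : (Ideal.span {q}).IsPrime) (hs : ¬ q ∣ s)
    (h : ∀ x : C, ∃ y : C, s • x = q • y) : ∃ a : Lam p, ¬ q ∣ a ∧ ∀ x : C, a • x = 0 := by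
  obtain ⟨P, hP, -, hcoeff, haeval⟩ :=
    LinearMap.exists_monic_and_natDegree_eq_and_coeff_mem_pow_and_aeval_eq_zero (Lam p)
      (algebraMap (Lam p) (Module.End (Lam p) C) s) (Ideal.span {q}) (by
        rintro _ ⟨x, rfl⟩
        obtain ⟨y, hy⟩ := h x
        rw [Module.algebraMap_end_apply, hy]
        exact Submodule.smul_mem_smul (Ideal.mem_span_singleton_self q) trivial)
  refine ⟨P.eval s, fun hdvd => hs ?_, fun x => ?_⟩
  · rw [Polynomial.eval_eq_sum_range, Finset.sum_range_succ, Polynomial.Monic.coeff_natDegree hP,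
      one_mul] at hdvd
    have h1 : q ∣ ∑ k ∈ Finset.range P.natDegree, P.coeff k * s ^ k := by
      refine Finset.dvd_sum fun k hk => Dvd.dvd.mul_right ?_ _
      rw [← Ideal.mem_span_singleton]
      have h2 : P.natDegree - k ≠ 0 := by
        have := Finset.mem_range.mp hk
        omega
      exact Ideal.pow_le_self h2 (hcoeff k)
    have h3 := (dvd_add_right h1).mp hdvd
    rw [← Ideal.mem_span_singleton] at h3 ⊢
    exact hq.mem_of_pow_mem _ h3
  · have h1 := LinearMap.congr_fun haeval x
    rw [Polynomial.aeval_algebraMap_apply, Module.algebraMap_end_apply, Polynomial.coe_aeval_eq_eval] at h1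
    exact h1

/-- The evaluation map from `X` to the dual of its module of functionals is surjective up to a
finite group. Otherwise the cokernel is, at some prime `(q)` or at `0`, not annihilated outside
`(q)`, so that some functional of the free module takes values in `(q)` on the image of `X`
without being divisible by `q`; but every functional of `X` comes from a unique functional of the
free module. -/
theorem finite_coker_pi_functionals [Module.Finite (Lam p) X] {r : ℕ}
    (φ : Fin r → X →ₗ[Lam p] Lam p)
    (hgen : ∀ ψ : X →ₗ[Lam p] Lam p, ∃ a : Fin r → Lam p, ψ = ∑ i, a i • φ i)
    (hind : ∀ a : Fin r → Lam p, ∑ i, a i • φ i = 0 → a = 0) :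
    Finite ((Fin r → Lam p) ⧸ LinearMap.range (LinearMap.pi φ)) := by
  set C := (Fin r → Lam p) ⧸ LinearMap.range (LinearMap.pi φ)
  have key : ∀ q : Lam p, (Ideal.span {q}).IsPrime →
      ∃ a : Lam p, ¬ q ∣ a ∧ ∀ x : C, a • x = 0 := by
    intro q hq
    let K := FractionRing (Lam p ⧸ Ideal.span {q})
    let j : Lam p →+* K := (algebraMap _ K).comp (Ideal.Quotient.mk (Ideal.span {q}))
    have hj : ∀ a, j a = 0 ↔ q ∣ a := fun a => by
      rw [RingHom.comp_apply, FaithfulSMul.algebraMap_eq_zero_iff, Ideal.Quotient.eq_zero_iff_mem,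
        Ideal.mem_span_singleton]
    have hdiv : ∀ k : K, ∃ a s, j s ≠ 0 ∧ j s * k = j a := fun k => by
      obtain ⟨a, s, hs, rfl⟩ := IsFractionRing.div_surjective (A := Lam p ⧸ Ideal.span {q}) k
      obtain ⟨a, rfl⟩ := Ideal.Quotient.mk_surjective a
      obtain ⟨s, rfl⟩ := Ideal.Quotient.mk_surjective s
      have hs0 : j s ≠ 0 := by
        simpa [j] using nonZeroDivisors.ne_zero hs
      exact ⟨a, s, hs0, mul_div_cancel₀ _ hs0⟩
    let Φ : X → (Fin r → K) := fun x i => j (φ i x)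
    by_cases hV : Submodule.span K (Set.range Φ) = ⊤
    · -- the image of `X` has full rank modulo `q`
      have h1 : ∀ w ∈ Submodule.span K (Set.range Φ), ∃ s, j s ≠ 0 ∧ ∃ x, j s • w = Φ x := by
        intro w hw
        induction hw using Submodule.span_induction with
        | mem w hw =>
          obtain ⟨x, rfl⟩ := hw
          exact ⟨1, by simp, x, by simp⟩
        | zero => exact ⟨1, by simp, 0, by ext i; simp [Φ]⟩
        | add w w' _ _ ih ih' =>
          obtain ⟨s, hs, x, hx⟩ := ih
          obtain ⟨s', hs', x', hx'⟩ := ih'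
          refine ⟨s * s', by rw [map_mul]; exact mul_ne_zero hs hs', s' • x + s • x', ?_⟩
          ext i
          have h2 := congrFun hx i
          have h3 := congrFun hx' i
          simp only [Pi.smul_apply, smul_eq_mul, Pi.add_apply, Φ, map_add, map_smul,
            map_mul] at h2 h3 ⊢
          linear_combination j s' * h2 + j s * h3
        | smul k w _ ih =>
          obtain ⟨s, hs, x, hx⟩ := ih
          obtain ⟨a, t, ht, hta⟩ := hdiv k
          refine ⟨t * s, by rw [map_mul]; exact mul_ne_zero ht hs, a • x, ?_⟩
          ext i
          have h2 := congrFun hx i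
          simp only [Pi.smul_apply, smul_eq_mul, Φ, map_smul, map_mul] at h2 ⊢
          linear_combination k * j t * h2 + j (φ i x) * hta
      have h2 : ∀ i : Fin r, ∃ s, j s ≠ 0 ∧ ∃ x, j s • (Pi.single i 1 : Fin r → K) = Φ x :=
        fun i => h1 _ (hV ▸ Submodule.mem_top)
      choose s hs x hx using h2
      refine exists_annihilator_not_dvd (C := C) (s := ∏ i, s i) hq ?_ ?_
      · rw [← hj, map_prod]
        exact Finset.prod_ne_zero_iff.mpr fun i _ => hs i
      · have h3 : ∀ i, ∃ y, s i • (Pi.single i 1 : Fin r → Lam p) - LinearMap.pi φ (x i) = q • y := by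
          intro i
          have h4 : ∀ k, q ∣ (s i • (Pi.single i 1 : Fin r → Lam p) - LinearMap.pi φ (x i)) k := by
            intro k
            rw [← hj, Pi.sub_apply, map_sub, sub_eq_zero]
            refine Eq.trans ?_ (congrFun (hx i) k)
            rw [Pi.smul_apply, Pi.smul_apply, smul_eq_mul, smul_eq_mul, map_mul]
            by_cases hik : k = i
            · subst hik
              simp
            · simp [Pi.single_eq_of_ne hik]
          choose y hy using h4
          exact ⟨y, funext hy⟩
        choose y hy using h3
        intro c
        obtain ⟨c, rfl⟩ := Submodule.Quotient.mk_surjective _ c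
        refine ⟨Submodule.Quotient.mk (∑ i, ((∏ k ∈ Finset.univ.erase i, s k) * c i) • y i), ?_⟩
        rw [← Submodule.Quotient.mk_smul, ← Submodule.Quotient.mk_smul, Submodule.Quotient.eq]
        refine ⟨∑ i, ((∏ k ∈ Finset.univ.erase i, s k) * c i) • x i, ?_⟩
        have h5 : (∏ i, s i) • c
            = ∑ i, ((∏ k ∈ Finset.univ.erase i, s k) * c i) • s i • (Pi.single i 1 : Fin r → Lam p) := by
          conv_lhs => rw [pi_eq_sum_univ' c, Finset.smul_sum]
          refine Finset.sum_congr rfl fun i _ => ?_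
          rw [smul_smul, smul_smul, ← Finset.mul_prod_erase Finset.univ s (Finset.mem_univ i)]
          congr 1
          · ring
        rw [h5, map_sum, Finset.smul_sum, ← Finset.sum_sub_distrib]
        refine Finset.sum_congr rfl fun i _ => ?_
        rw [map_smul, smul_comm q, ← hy i, smul_sub, sub_sub_cancel]
    · -- otherwise a functional over the residue field of `(q)` kills the image of `X`
      exfalso
      obtain ⟨f, hf, hle⟩ := Submodule.exists_le_ker_of_lt_top _ (lt_top_iff_ne_top.mpr hV)
      choose a s hs ha using fun i : Fin r => hdiv (f (Pi.single i 1))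
      let u : Fin r → Lam p := fun i => (∏ k ∈ Finset.univ.erase i, s k) * a i
      have hu : ∀ i, j (u i) = j (∏ k, s k) * f (Pi.single i 1) := fun i => by
        rw [map_mul, ← ha, ← mul_assoc, ← map_mul, mul_comm (∏ k ∈ _, s k),
          Finset.mul_prod_erase Finset.univ s (Finset.mem_univ i)]
      have hs0 : j (∏ k, s k) ≠ 0 := by
        rw [map_prod]
        exact Finset.prod_ne_zero_iff.mpr fun i _ => hs i
      have hdvd : ∀ x, q ∣ (∑ i, u i • φ i) x := fun x => by
        have h1 : f (Φ x) = 0 := hle (Submodule.subset_span ⟨x, rfl⟩)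
        rw [pi_eq_sum_univ' (Φ x), map_sum] at h1
        rw [← hj, LinearMap.sum_apply, map_sum]
        simp only [LinearMap.smul_apply, smul_eq_mul, map_mul, hu]
        rw [← mul_zero (j (∏ k, s k)), ← h1, Finset.mul_sum]
        refine Finset.sum_congr rfl fun i _ => ?_
        rw [map_smul, smul_eq_mul, map_prod]
        ring
      have hudvd : ∀ i, q ∣ u i := by
        by_cases hq0 : q = 0
        · subst hq0
          have h1 := hind u (LinearMap.ext fun x => zero_dvd_iff.mp (hdvd x))
          intro i
          rw [h1]
          exact dvd_zero _
        · obtain ⟨ψ, hψ⟩ := exists_eq_smul_of_forall_dvd hq0 _ hdvd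
          obtain ⟨c, rfl⟩ := hgen ψ
          have h1 := hind (fun i => u i - q * c i) (LinearMap.ext fun x => by
            have h2 := LinearMap.congr_fun hψ x
            simp only [LinearMap.sum_apply, LinearMap.smul_apply, smul_eq_mul, Finset.mul_sum,
              LinearMap.zero_apply, sub_mul, Finset.sum_sub_distrib, mul_assoc] at h2 ⊢
            rw [h2, sub_self])
          intro i
          exact ⟨c i, sub_eq_zero.mp (congrFun h1 i)⟩
      refine hf (LinearMap.pi_ext' fun i => LinearMap.ext_ring ?_)
      have h1 := (hj _).mpr (hudvd i)
      rw [hu, mul_eq_zero] at h1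
      simpa using h1.resolve_left hs0
  obtain ⟨a, ha0, ha⟩ := key 0 (by
    rw [Ideal.span_singleton_eq_bot.mpr rfl]
    exact Ideal.isPrime_bot)
  rw [zero_dvd_iff] at ha0
  obtain ⟨b, hb, hab⟩ := exists_mem_isRelPrime ha0 (Module.annihilator (Lam p) C) fun q hq => by
    obtain ⟨b, hqb, hb⟩ := key q ((Ideal.span_singleton_prime hq.ne_zero).mpr hq)
    exact ⟨b, Module.mem_annihilator.mpr hb, hqb⟩
  exact finite_of_isRelPrime C hab ha (Module.mem_annihilator.mp hb)

end Functionals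

/-! ### Localization at finitely many primes of height one -/

section Localization

theorem exists_common_annihilator {M : Type*} [AddCommGroup M] [Module (Lam p) M]
    [Module.Finite (Lam p) M] (S : Submonoid (Lam p)) (h : ∀ x : M, ∃ s ∈ S, s • x = 0) :
    ∃ s ∈ S, ∀ x : M, s • x = 0 := by
  obtain ⟨k, π, hπ⟩ := Module.Finite.exists_fin' (Lam p) M
  choose s hs hsx using fun i : Fin k => h (π (Pi.single i 1))
  refine ⟨∏ i, s i, S.prod_mem fun i _ => hs i, fun x => ?_⟩
  obtain ⟨c, rfl⟩ := hπ x
  rw [pi_eq_sum_univ' c, map_sum, Finset.smul_sum]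
  refine Finset.sum_eq_zero fun i _ => ?_
  rw [map_smul, smul_comm, ← Finset.prod_erase_mul Finset.univ s (Finset.mem_univ i), mul_smul]
  have := hsx i
  rw [this, smul_zero, smul_zero]

/-- A map into a module `B` that contains `A` lands in `A` after multiplication by some element of
`S`, if every element of `B` does. -/
theorem exists_lift_of_submonoid {X A B : Type*} [AddCommGroup X] [Module (Lam p) X]
    [Module.Finite (Lam p) X] [AddCommGroup A] [Module (Lam p) A] [AddCommMonoid B]
    [Module (Lam p) B] (S : Submonoid (Lam p)) (j : A →ₗ[Lam p] B) (hj : Function.Injective j)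
    (hS : ∀ b, ∃ s ∈ S, ∃ a, j a = s • b) (g : X →ₗ[Lam p] B) :
    ∃ s ∈ S, ∃ u : X →ₗ[Lam p] A, ∀ x, j (u x) = s • g x := by
  obtain ⟨s, hs, hsx⟩ := exists_common_annihilator
    (M := X ⧸ (LinearMap.range j).comap g) S fun x => by
      obtain ⟨x, rfl⟩ := Submodule.Quotient.mk_surjective _ x
      obtain ⟨s, hs, a, ha⟩ := hS (g x)
      refine ⟨s, hs, (Submodule.Quotient.mk_eq_zero _).mpr ⟨a, ?_⟩⟩
      rw [ha, map_smul]
  obtain ⟨u, hu⟩ := exists_lift_of_injective j hj (s • g) fun x => by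
    obtain ⟨a, ha⟩ := (Submodule.Quotient.mk_eq_zero _).mp (hsx (Submodule.Quotient.mk x))
    exact ⟨a, by rw [ha, map_smul]; rfl⟩
  exact ⟨s, hs, u, hu⟩

/-- The elements of `Λ` that are coprime to `f`, that is, the complement of the union of the primes
`(q)` with `q ∣ f`. -/
def coprimeTo (f : Lam p) : Submonoid (Lam p) where
  carrier := {s | IsRelPrime f s}
  one_mem' := isRelPrime_one_right
  mul_mem' ha hb := IsRelPrime.mul_right ha hb

theorem mem_coprimeTo {f s : Lam p} : s ∈ coprimeTo f ↔ IsRelPrime f s := Iff.rfl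

variable {f : Lam p}

theorem coprimeTo_le_nonZeroDivisors (hu : ¬ IsUnit f) :
    coprimeTo f ≤ nonZeroDivisors (Lam p) := by
  intro s hs
  rw [mem_nonZeroDivisors_iff_ne_zero]
  rintro rfl
  exact hu (hs dvd_rfl (dvd_zero f))

/-- The nonzero primes of the localization at `coprimeTo f` are generated by the prime divisors of `f`,
by prime avoidance. -/
theorem exists_prime_span_eq (hf : f ≠ 0) (P : Ideal (Localization (coprimeTo f)))
    [hP : P.IsPrime] (hP0 : P ≠ ⊥) :
    ∃ q : Lam p, Prime q ∧ q ∣ f ∧ P = Ideal.span {algebraMap _ _ q} := by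
  have hmap := IsLocalization.map_under (coprimeTo f) _ P
  set P' := P.under (Lam p)
  have hS : ∀ x ∈ P', ¬ IsRelPrime f x := fun x hx hfx =>
    hP.ne_top (Ideal.eq_top_of_isUnit_mem _ hx
      (IsLocalization.map_units (Localization (coprimeTo f)) (⟨x, hfx⟩ : coprimeTo f)))
  obtain ⟨q, hq, hqP⟩ : ∃ q : Lam p, Prime q ∧ ∀ y ∈ P', q ∣ y := by
    by_contra! h
    obtain ⟨x, hx, hfx⟩ := exists_mem_isRelPrime hf P' h
    exact hS x hx hfx
  have hP'0 : P' ≠ ⊥ := fun h => hP0 (by rw [← hmap, h, Ideal.map_bot])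
  have hP' : P'.IsPrime := inferInstanceAs (P.under (Lam p)).IsPrime
  obtain ⟨q', hq'P, hq'⟩ := hP'.exists_mem_prime_of_ne_bot hP'0
  have hqmem : q ∈ P' := by
    obtain ⟨u, hu⟩ := ((hq.dvd_prime_iff_associated hq').mp (hqP q' hq'P)).symm
    rw [← hu]
    exact P'.mul_mem_right _ hq'P
  have hP'q : P' = Ideal.span {q} :=
    le_antisymm (fun y hy => Ideal.mem_span_singleton.mpr (hqP y hy))
      ((Ideal.span_singleton_le_iff_mem _).mpr hqmem)
  refine ⟨q, hq, ?_, ?_⟩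
  · by_contra h
    exact hS q hqmem ((hq.irreducible.isRelPrime_iff_not_dvd).mpr h).symm
  · rw [← hmap, hP'q, Ideal.map_span, Set.image_singleton]

theorem isPrincipalIdealRing_localization (hf : f ≠ 0) :
    IsPrincipalIdealRing (Localization (coprimeTo f)) :=
  IsPrincipalIdealRing.of_prime_ne_bot fun P _ hP0 => by
    obtain ⟨q, -, -, rfl⟩ := exists_prime_span_eq hf P hP0
    exact ⟨⟨_, rfl⟩⟩

/-- `Λ / q ^ e` embeds into its localization. -/
theorem exists_cyc_localization (hu : ¬ IsUnit f) {q : Lam p} (hqf : q ∣ f) (e : ℕ)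
    {P : Localization (coprimeTo f)} (hP : Ideal.span {P} = Ideal.span {algebraMap _ _ q}) :
    ∃ j : cyc (q ^ e) →ₗ[Lam p] (Localization (coprimeTo f) ⧸ Ideal.span {P ^ e}),
      Function.Injective j ∧ ∀ b, ∃ s ∈ coprimeTo f, ∃ a, j a = s • b := by
  have hPe : Ideal.span {P ^ e}
      = Ideal.span {algebraMap (Lam p) (Localization (coprimeTo f)) (q ^ e)} := by
    rw [← Ideal.span_singleton_pow, hP, Ideal.span_singleton_pow, map_pow]
  have hinj := IsLocalization.injective (Localization (coprimeTo f))
    (coprimeTo_le_nonZeroDivisors hu)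
  let j₀ : Lam p →ₗ[Lam p] (Localization (coprimeTo f) ⧸ Ideal.span {P ^ e}) :=
    ((Ideal.span {P ^ e}).mkQ.restrictScalars (Lam p)) ∘ₗ Algebra.linearMap _ _
  have hj₀ : ∀ a, j₀ a = 0 ↔ q ^ e ∣ a := by
    intro a
    change Submodule.Quotient.mk (algebraMap (Lam p) (Localization (coprimeTo f)) a) = 0 ↔ _
    rw [Submodule.Quotient.mk_eq_zero, hPe, Ideal.mem_span_singleton]
    refine ⟨?_, map_dvd _⟩
    rintro ⟨b, hb⟩
    obtain ⟨⟨c, s⟩, hc⟩ := IsLocalization.surj (coprimeTo f) b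
    have h1 : a * s = q ^ e * c := hinj (by
      rw [map_mul, map_mul, hb, mul_assoc, hc])
    have h2 : IsRelPrime (q ^ e) (s : Lam p) :=
      IsRelPrime.pow_left fun d hd hds => s.2 (hd.trans hqf) hds
    exact h2.dvd_of_dvd_mul_right ⟨c, h1⟩
  have hle : Ideal.span {q ^ e} ≤ LinearMap.ker j₀ := fun a ha =>
    (hj₀ a).mpr (Ideal.mem_span_singleton.mp ha)
  refine ⟨Submodule.liftQ _ j₀ hle, ?_, ?_⟩
  · rw [injective_iff_map_eq_zero]
    intro a ha
    obtain ⟨a, rfl⟩ := Submodule.Quotient.mk_surjective _ a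
    exact (Submodule.Quotient.mk_eq_zero _).mpr (Ideal.mem_span_singleton.mpr ((hj₀ a).mp ha))
  · intro b
    obtain ⟨b, rfl⟩ := Submodule.Quotient.mk_surjective _ b
    obtain ⟨⟨c, s⟩, hc⟩ := IsLocalization.surj (coprimeTo f) b
    refine ⟨s, s.2, Submodule.Quotient.mk c, ?_⟩
    change Submodule.Quotient.mk (algebraMap (Lam p) (Localization (coprimeTo f)) c) = _
    rw [← hc, ← Submodule.Quotient.mk_smul]
    congr 1
    rw [mul_comm, Algebra.smul_def]

/-- The structure theorem over the principal ideal domain obtained from `Λ` by inverting the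
elements coprime to `f`, with denominators cleared. -/
theorem exists_map_elementary_localization (hf : f ≠ 0) (hu : ¬ IsUnit f) (X : Type*)
    [AddCommGroup X] [Module (Lam p) X] [Module.Finite (Lam p) X] :
    ∃ (n : ℕ) (ι : Type) (_ : Fintype ι) (q : ι → Lam p) (e : ι → ℕ)
      (U : X →ₗ[Lam p] (Fin n → Lam p) × (∀ i, cyc (q i ^ e i))),
      (∀ i, Prime (q i)) ∧ (∀ i, q i ∣ f) ∧
      (∀ x, U x = 0 → ∃ s, IsRelPrime f s ∧ s • x = 0) ∧
      ∀ y, ∃ s, IsRelPrime f s ∧ ∃ x, U x = s • y := by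
  have hnz := coprimeTo_le_nonZeroDivisors hu
  have hdom : IsDomain (Localization (coprimeTo f)) := IsLocalization.isDomain_localization hnz
  have hpid := isPrincipalIdealRing_localization hf
  have hinj := IsLocalization.injective (Localization (coprimeTo f)) hnz
  have hfin : Module.Finite (Localization (coprimeTo f)) (LocalizedModule (coprimeTo f) X) :=
    Module.Finite.of_isLocalizedModule (coprimeTo f) (LocalizedModule.mkLinearMap (coprimeTo f) X)
  obtain ⟨n, ι, _, P, hP, e, ⟨E⟩⟩ := Module.equiv_free_prod_directSum
    (R := Localization (coprimeTo f)) (M := LocalizedModule (coprimeTo f) X)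
  have hPq : ∀ i, ∃ q : Lam p, Prime q ∧ q ∣ f ∧
      Ideal.span {P i} = Ideal.span {algebraMap _ (Localization (coprimeTo f)) q} := fun i => by
    have := (Ideal.span_singleton_prime (hP i).ne_zero).mpr (hP i).prime
    exact exists_prime_span_eq hf _ (by
      rw [Ne, Ideal.span_singleton_eq_bot]
      exact (hP i).ne_zero)
  choose q hq hqf hPq using hPq
  choose j hjinj hjS using fun i => exists_cyc_localization hu (hqf i) (e i) (hPq i)
  classical
  let E' := E.trans ((Finsupp.linearEquivFunOnFinite (Localization (coprimeTo f))
    (Localization (coprimeTo f)) (Fin n)).prodCongr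
    (DirectSum.linearEquivFunOnFintype (Localization (coprimeTo f)) ι
      (fun i => Localization (coprimeTo f) ⧸ Ideal.span {P i ^ e i})))
  let J : ((Fin n → Lam p) × (∀ i, cyc (q i ^ e i))) →ₗ[Lam p]
      ((Fin n → Localization (coprimeTo f)) ×
        (∀ i, Localization (coprimeTo f) ⧸ Ideal.span {P i ^ e i})) :=
    (LinearMap.pi fun k => Algebra.linearMap _ _ ∘ₗ LinearMap.proj k).prodMap
      (LinearMap.pi fun i => j i ∘ₗ LinearMap.proj i)
  have hJ : Function.Injective J := by
    rintro ⟨a, y⟩ ⟨a', y'⟩ h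
    refine Prod.ext (funext fun k => hinj ?_) (funext fun i => hjinj i ?_)
    · exact congrFun (congrArg Prod.fst h) k
    · exact congrFun (congrArg Prod.snd h) i
  have hJS : ∀ b, ∃ s ∈ coprimeTo f, ∃ a, J a = s • b := by
    rintro ⟨b, z⟩
    choose a ha using fun k => IsLocalization.surj (coprimeTo f) (b k)
    choose s hs y hy using fun i => hjS i (z i)
    refine ⟨(∏ k, ((a k).2 : Lam p)) * ∏ i, s i, mul_mem (prod_mem fun k _ => (a k).2.2)
      (prod_mem fun i _ => hs i),
      ⟨fun k => ((∏ k ∈ Finset.univ.erase k, ((a k).2 : Lam p)) * ∏ i, s i) * (a k).1,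
        fun i => ((∏ k, ((a k).2 : Lam p)) * ∏ i ∈ Finset.univ.erase i, s i) • y i⟩, ?_⟩
    refine Prod.ext (funext fun k => ?_) (funext fun i => ?_)
    · change algebraMap (Lam p) (Localization (coprimeTo f))
          (((∏ k ∈ Finset.univ.erase k, ((a k).2 : Lam p)) * ∏ i, s i) * (a k).1)
        = ((∏ k, ((a k).2 : Lam p)) * ∏ i, s i) • b k
      rw [map_mul, ← ha k, Algebra.smul_def, mul_comm (b k), ← mul_assoc, ← map_mul]
      congr 2
      rw [← Finset.prod_erase_mul Finset.univ (fun k => ((a k).2 : Lam p)) (Finset.mem_univ k)]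
      ring
    · change j i (((∏ k, ((a k).2 : Lam p)) * ∏ i ∈ Finset.univ.erase i, s i) • y i)
        = ((∏ k, ((a k).2 : Lam p)) * ∏ i, s i) • z i
      rw [map_smul, hy, smul_smul]
      congr 1
      rw [← Finset.prod_erase_mul Finset.univ s (Finset.mem_univ i)]
      ring
  let g : X →ₗ[Lam p] _ := (E'.toLinearMap.restrictScalars (Lam p)) ∘ₗ
    LocalizedModule.mkLinearMap (coprimeTo f) X
  obtain ⟨s, hs, U, hU⟩ := exists_lift_of_submonoid (coprimeTo f) J hJ hJS g
  refine ⟨n, ι, inferInstance, q, e, U, hq, hqf, fun x hx => ?_, fun y => ?_⟩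
  · have h1 : g (s • x) = 0 := by rw [map_smul, ← hU, hx, map_zero]
    have h2 : LocalizedModule.mkLinearMap (coprimeTo f) X (s • x) = 0 :=
      E'.injective (h1.trans (map_zero E').symm)
    obtain ⟨t, ht⟩ := (IsLocalizedModule.eq_zero_iff (coprimeTo f) _).mp h2
    exact ⟨t * s, mul_mem t.2 hs, by rw [mul_smul]; exact ht⟩
  · obtain ⟨⟨x, t⟩, hx⟩ := IsLocalizedModule.surj (coprimeTo f)
      (LocalizedModule.mkLinearMap (coprimeTo f) X) (E'.symm (J y))
    refine ⟨s * t, mul_mem hs t.2, x, hJ ?_⟩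
    have h1 : g x = (t : Lam p) • J y := by
      change E' (LocalizedModule.mkLinearMap (coprimeTo f) X x) = _
      rw [← hx]
      change (E'.toLinearMap.restrictScalars (Lam p)) ((t : Lam p) • E'.symm (J y)) = _
      rw [map_smul]
      exact congrArg _ (E'.apply_symm_apply _)
    rw [hU, h1, mul_smul s (t : Lam p) y, map_smul, map_smul]

end Localization

/-! ### Composition and symmetry of pseudo-isomorphisms -/

section PseudoIso

variable {M N : Type*} [AddCommGroup M] [Module (Lam p) M] [AddCommGroup N] [Module (Lam p) N]

/-- The element `a` kills the kernel and the cokernel of `u`. -/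
def Controls (u : M →ₗ[Lam p] N) (a : Lam p) : Prop :=
  (∀ x, u x = 0 → a • x = 0) ∧ ∀ y, ∃ x, u x = a • y

theorem isRelPrime_natCast_pow_X_pow (k : ℕ) :
    IsRelPrime ((p : Lam p) ^ k) (PowerSeries.X ^ k) :=
  isRelPrime_natCast_X.pow

theorem exists_controls (u : M →ₗ[Lam p] N) [Finite (LinearMap.ker u)]
    [Finite (N ⧸ LinearMap.range u)] :
    ∃ k : ℕ, ∀ a ∈ maximalIdeal (Lam p), Controls u (a ^ k) := by
  obtain ⟨k, hk⟩ := exists_pow_of_finite u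
  exact ⟨k, fun a ha => hk _ (Ideal.pow_mem_pow ha k)⟩

theorem hasPseudoIso_of_controls [Module.Finite (Lam p) M] [Module.Finite (Lam p) N]
    (u : M →ₗ[Lam p] N) {a b : Lam p} (hab : IsRelPrime a b) (ha : Controls u a)
    (hb : Controls u b) : HasPseudoIso p M N := by
  refine ⟨u, ?_, ?_⟩
  · exact finite_of_isRelPrime _ hab (fun x => Subtype.ext (ha.1 x x.2))
      (fun x => Subtype.ext (hb.1 x x.2))
  · refine finite_of_isRelPrime _ hab (fun y => ?_) (fun y => ?_)
    all_goals
      obtain ⟨y, rfl⟩ := Submodule.Quotient.mk_surjective _ y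
      refine (Submodule.Quotient.mk_eq_zero _).mpr ?_
    exacts [ha.2 y, hb.2 y]

theorem Controls.comp {L : Type*} [AddCommGroup L] [Module (Lam p) L] {v : N →ₗ[Lam p] L}
    {u : M →ₗ[Lam p] N} {a b : Lam p} (hv : Controls v a) (hu : Controls u b) :
    Controls (v ∘ₗ u) (a * b) := by
  refine ⟨fun x hx => ?_, fun z => ?_⟩
  · have h1 := hv.1 (u x) hx
    rw [← map_smul] at h1
    have := hu.1 _ h1
    rwa [smul_smul, mul_comm] at this
  · obtain ⟨y, hy⟩ := hv.2 z
    obtain ⟨x, hx⟩ := hu.2 y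
    exact ⟨x, by rw [LinearMap.comp_apply, hx, map_smul, hy, smul_smul, mul_comm]⟩

theorem HasPseudoIso.trans {L : Type*} [AddCommGroup L] [Module (Lam p) L]
    [Module.Finite (Lam p) M] [Module.Finite (Lam p) L] (h : HasPseudoIso p M N)
    (h' : HasPseudoIso p N L) : HasPseudoIso p M L := by
  obtain ⟨u, hu1, hu2⟩ := h
  obtain ⟨v, hv1, hv2⟩ := h'
  obtain ⟨k, hk⟩ := exists_controls u
  obtain ⟨l, hl⟩ := exists_controls v
  refine hasPseudoIso_of_controls (v ∘ₗ u) (isRelPrime_natCast_pow_X_pow (l + k)) ?_ ?_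
  · rw [pow_add]
    exact (hl _ natCast_mem_maximalIdeal).comp (hk _ natCast_mem_maximalIdeal)
  · rw [pow_add]
    exact (hl _ X_mem_maximalIdeal).comp (hk _ X_mem_maximalIdeal)

theorem hasPseudoIso_of_equiv (e : M ≃ₗ[Lam p] N) : HasPseudoIso p M N := by
  refine ⟨e.toLinearMap, ?_, ?_⟩
  · rw [LinearEquiv.ker]
    infer_instance
  · rw [LinearEquiv.range]
    infer_instance

/-- Between finitely generated modules killed by a nonzero element `a`, the relation of
pseudo-isomorphism is symmetric. For `x` in the maximal ideal and coprime to `a`, and `k` large, the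
map `y ↦ x ^ k m` with `u m = x ^ k y` is well defined, and its kernel and cokernel are killed by
`x ^ (2 k)` and by `a`. -/
theorem HasPseudoIso.symm [Module.Finite (Lam p) M] [Module.Finite (Lam p) N]
    (h : HasPseudoIso p M N) {a : Lam p} (ha : a ≠ 0) (haM : ∀ m : M, a • m = 0)
    (haN : ∀ n : N, a • n = 0) : HasPseudoIso p N M := by
  obtain ⟨u, hu1, hu2⟩ := h
  obtain ⟨k, hk⟩ := exists_controls u
  obtain ⟨x, hx, hax⟩ := exists_mem_maximalIdeal_isRelPrime ha
  obtain ⟨hx1, hx2⟩ := hk x hx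
  obtain ⟨w, hw⟩ := exists_lift_of_injective ((LinearMap.ker u).liftQ u le_rfl)
    (by rw [← LinearMap.ker_eq_bot, Submodule.ker_liftQ_eq_bot]; exact le_rfl)
    (LinearMap.lsmul (Lam p) N (x ^ k)) fun y => by
      obtain ⟨m, hm⟩ := hx2 y
      exact ⟨Submodule.Quotient.mk m, hm⟩
  have hle : LinearMap.ker u ≤ LinearMap.ker (LinearMap.lsmul (Lam p) M (x ^ k)) :=
    fun m hm => hx1 m hm
  let v : N →ₗ[Lam p] M :=
    (LinearMap.ker u).liftQ (LinearMap.lsmul (Lam p) M (x ^ k)) hle ∘ₗ w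
  have hv : ∀ y, ∃ m, u m = x ^ k • y ∧ v y = x ^ k • m := fun y => by
    obtain ⟨m, hm⟩ := Submodule.Quotient.mk_surjective _ (w y)
    refine ⟨m, ?_, ?_⟩
    · have := hw y
      rw [← hm] at this
      exact this
    · change (LinearMap.ker u).liftQ (LinearMap.lsmul (Lam p) M (x ^ k)) hle (w y) = _
      rw [← hm]
      rfl
  refine hasPseudoIso_of_controls v (a := a) (b := x ^ k * x ^ k)
    (IsRelPrime.mul_right hax.pow_right hax.pow_right)
    ⟨fun y _ => haN y, fun m => ⟨0, by rw [haM, map_zero]⟩⟩ ⟨fun y hy => ?_, fun m => ⟨u m, ?_⟩⟩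
  · obtain ⟨m, hm, hm'⟩ := hv y
    rw [hy] at hm'
    rw [mul_smul, ← hm, ← map_smul, ← hm', map_zero]
  · obtain ⟨m', hm, hm'⟩ := hv (u m)
    rw [hm', mul_smul, ← sub_eq_zero, ← smul_sub]
    exact hx1 _ (by rw [map_sub, map_smul, hm, sub_self])

end PseudoIso

/-! ### The structure of finitely generated modules up to pseudo-isomorphism -/

/-- A nonzero nonunit that kills the torsion of a finitely generated module. -/
theorem exists_torsion_annihilator (X : Type*) [AddCommGroup X] [Module (Lam p) X]
    [Module.Finite (Lam p) X] : ∃ f : Lam p, f ≠ 0 ∧ ¬ IsUnit f ∧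
      ∀ (a : Lam p) (x : X), a ≠ 0 → a • x = 0 → f • x = 0 := by
  obtain ⟨b, hb, hbx⟩ := exists_common_annihilator (M := Submodule.torsion (Lam p) X)
    (nonZeroDivisors (Lam p)) fun x => by
      obtain ⟨c, hc⟩ := x.2
      exact ⟨c, c.2, Subtype.ext hc⟩
  refine ⟨p * b, mul_ne_zero prime_natCast.ne_zero (nonZeroDivisors.ne_zero hb), fun h => ?_,
    fun a x ha hax => ?_⟩
  · exact prime_natCast.not_isUnit (isUnit_of_mul_isUnit_left h)
  · rw [mul_smul]
    have h1 : b • x = 0 := congrArg Subtype.val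
      (hbx ⟨x, ⟨a, mem_nonZeroDivisors_of_ne_zero ha⟩, hax⟩)
    rw [h1, smul_zero]

/-- Every finitely generated module has a pseudo-isomorphism to a finite direct sum of cyclic
modules `Λ` and `Λ / q ^ e` with `q` prime. It combines the evaluation map to the dual of the module
of functionals, which is bijective up to finite groups on the torsion free quotient, with the
projection to the torsion part of a localization that is a principal ideal domain. -/
theorem exists_hasPseudoIso_elementary (X : Type*) [AddCommGroup X] [Module (Lam p) X]
    [Module.Finite (Lam p) X] : ∃ (r : ℕ) (ι : Type) (_ : Fintype ι) (q : ι → Lam p) (e : ι → ℕ),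
      (∀ i, Prime (q i)) ∧ HasPseudoIso p X ((Fin r → Lam p) × (∀ i, cyc (q i ^ e i))) := by
  obtain ⟨r, φ, hgen, hind⟩ := exists_basis_functionals (p := p) X
  have _ := finite_coker_pi_functionals φ hgen hind
  obtain ⟨k, hk⟩ := exists_pow_maximalIdeal_smul (p := p)
    ((Fin r → Lam p) ⧸ LinearMap.range (LinearMap.pi φ))
  obtain ⟨f, hf0, hfu, hf⟩ := exists_torsion_annihilator (p := p) X
  obtain ⟨n, ι, _, q, e, U, hq, hqf, hker, hcoker⟩ :=
    exists_map_elementary_localization hf0 hfu X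
  have hs0 : ∀ s, IsRelPrime f s → s ≠ 0 := fun s hs h => by
    subst h
    exact hfu (hs dvd_rfl (dvd_zero f))
  let u : X →ₗ[Lam p] (∀ i, cyc (q i ^ e i)) := LinearMap.snd _ _ _ ∘ₗ U
  have hE : ∀ y : ∀ i, cyc (q i ^ e i), f ^ (∑ i, e i) • y = 0 := fun y => funext fun i => by
    obtain ⟨c, hc⟩ := Submodule.Quotient.mk_surjective _ (y i)
    rw [Pi.smul_apply, ← hc, Pi.zero_apply, ← Submodule.Quotient.mk_smul,
      Submodule.Quotient.mk_eq_zero, Ideal.mem_span_singleton]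
    refine Dvd.dvd.mul_right ((pow_dvd_pow_of_dvd (hqf i) _).trans (pow_dvd_pow f ?_)) c
    exact Finset.single_le_sum (fun _ _ => Nat.zero_le _) (Finset.mem_univ i)
  -- the torsion of `X` lies in the kernel of the evaluation map
  have hφtor : ∀ (a : Lam p) (x : X), a ≠ 0 → a • x = 0 → LinearMap.pi φ x = 0 :=
    fun a x ha hax => funext fun i => by
      have : a * φ i x = 0 := by rw [← smul_eq_mul, ← map_smul, hax, map_zero]
      exact (mul_eq_zero.mp this).resolve_left ha
  -- each functional is a combination of the `φ i`, in particular each coordinate of `U x` in the free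
  -- part
  have hUφ : ∀ x, LinearMap.pi φ x = 0 → (U x).1 = 0 := fun x hx => funext fun i => by
    obtain ⟨a, ha⟩ := hgen (LinearMap.proj i ∘ₗ LinearMap.fst _ _ _ ∘ₗ U)
    refine (LinearMap.congr_fun ha x).trans ?_
    rw [LinearMap.sum_apply]
    refine Finset.sum_eq_zero fun j _ => ?_
    have : φ j x = 0 := congrFun hx j
    rw [LinearMap.smul_apply, this, smul_zero]
  -- the torsion part is reached, up to a finite group, by elements on which the evaluation map vanishes
  have hW : Finite ((∀ i, cyc (q i ^ e i)) ⧸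
      (LinearMap.ker (LinearMap.pi φ)).map u) := by
    obtain ⟨s, hs, hsx⟩ := exists_common_annihilator
      (M := (∀ i, cyc (q i ^ e i)) ⧸ (LinearMap.ker (LinearMap.pi φ)).map u) (coprimeTo f)
      fun y => by
        obtain ⟨y, rfl⟩ := Submodule.Quotient.mk_surjective _ y
        obtain ⟨s, hs, x, hx⟩ := hcoker (0, y)
        refine ⟨s, hs, (Submodule.Quotient.mk_eq_zero _).mpr ⟨x, ?_, congrArg Prod.snd hx⟩⟩
        obtain ⟨t, ht, htx⟩ := hker (f ^ (∑ i, e i) • x) (by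
          rw [map_smul, hx]
          refine Prod.ext ?_ ?_
          · change f ^ (∑ i, e i) • s • (0 : Fin n → Lam p) = 0
            rw [smul_zero, smul_zero]
          · change f ^ (∑ i, e i) • s • y = 0
            rw [hE])
        rw [smul_smul] at htx
        exact hφtor _ x (mul_ne_zero (hs0 t ht) (pow_ne_zero _ hf0)) htx
    refine finite_of_isRelPrime _ (IsRelPrime.pow_left (m := ∑ i, e i) (mem_coprimeTo.mp hs))
      (fun y => ?_) hsx
    obtain ⟨y, rfl⟩ := Submodule.Quotient.mk_surjective _ y
    rw [← Submodule.Quotient.mk_smul, hE, Submodule.Quotient.mk_zero]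
  obtain ⟨l, hl⟩ := exists_pow_maximalIdeal_smul (p := p)
    ((∀ i, cyc (q i ^ e i)) ⧸ (LinearMap.ker (LinearMap.pi φ)).map u)
  refine ⟨r, ι, inferInstance, q, e, hq, (LinearMap.pi φ).prod u, ?_, ?_⟩
  · -- the kernel is torsion and dies in the localization, hence is killed by `f` and by some `s` coprime
    -- to `f`
    have hz : ∀ x : LinearMap.ker ((LinearMap.pi φ).prod u), U x = 0 := fun x => by
      have h1 : (LinearMap.pi φ x.1, u x.1) = 0 := x.2
      exact Prod.ext (hUφ x (congrArg Prod.fst h1)) (congrArg Prod.snd h1 : u x = 0)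
    obtain ⟨s, hs, hsx⟩ := exists_common_annihilator
      (M := LinearMap.ker ((LinearMap.pi φ).prod u)) (coprimeTo f) fun x => by
        obtain ⟨s, hs, hsx⟩ := hker x (hz x)
        exact ⟨s, hs, Subtype.ext hsx⟩
    exact finite_of_isRelPrime _ (mem_coprimeTo.mp hs)
      (fun x => Subtype.ext (hf s x (hs0 s hs) (congrArg Subtype.val (hsx x)))) hsx
  · have key : ∀ a ∈ maximalIdeal (Lam p),
        ∀ y : ((Fin r → Lam p) × (∀ i, cyc (q i ^ e i))) ⧸ LinearMap.range ((LinearMap.pi φ).prod u),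
        a ^ (l + k) • y = 0 := by
      intro a ha y
      obtain ⟨⟨c, y⟩, rfl⟩ := Submodule.Quotient.mk_surjective _ y
      obtain ⟨x, hx : LinearMap.pi φ x = a ^ k • c⟩ := (Submodule.Quotient.mk_eq_zero _).mp
        (hk _ (Ideal.pow_mem_pow ha k) (Submodule.Quotient.mk c))
      obtain ⟨x', hx', hx''⟩ := (Submodule.Quotient.mk_eq_zero _).mp
        (hl _ (Ideal.pow_mem_pow ha l) (Submodule.Quotient.mk (a ^ k • y - u x)))
      -- `x` has the right image in the free part, and `x'` corrects the torsion part
      refine (Submodule.Quotient.mk_eq_zero _).mpr ⟨a ^ l • x + x', Prod.ext ?_ ?_⟩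
      · change LinearMap.pi φ (a ^ l • x + x') = a ^ (l + k) • c
        rw [map_add, map_smul, hx, LinearMap.mem_ker.mp hx', add_zero, pow_add, mul_smul]
      · change u (a ^ l • x + x') = a ^ (l + k) • y
        have h1 : u x' = a ^ l • (a ^ k • y - u x) := hx''
        rw [map_add, map_smul, h1, smul_sub, add_sub_cancel, pow_add, mul_smul]
    exact finite_of_isRelPrime _ (isRelPrime_natCast_pow_X_pow (l + k))
      (key _ natCast_mem_maximalIdeal) (key _ X_mem_maximalIdeal)

/-! ### Finite products -/

section Products

variable {ι : Type*} [Fintype ι] (M : ι → Type*) [∀ i, AddCommGroup (M i)]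
  [∀ i, Module (Lam p) (M i)]

/-- The functor `𝔉` takes finite products to products. -/
theorem nonempty_F_pi_equiv : Nonempty (F p (∀ i, M i) ≃ₗ[Lam p] ∀ i, F p (M i)) := by
  classical
  have hδ : ∀ i j (z : DirLim p (M i)), dirLimMap (LinearMap.proj j)
      (dirLimMap (LinearMap.single (Lam p) M i) z)
      = dirLimMap (LinearMap.proj j ∘ₗ LinearMap.single (Lam p) M i) z :=
    fun i j z => (dirLimMap_comp _ _ z).symm
  have hsum : ∀ z : DirLim p (∀ i, M i), ∑ i, dirLimMap (LinearMap.single (Lam p) M i)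
      (dirLimMap (LinearMap.proj i) z) = z := fun z => by
    simp only [← dirLimMap_comp]
    rw [← dirLimMap_sum]
    have : ∑ i, LinearMap.single (Lam p) M i ∘ₗ LinearMap.proj i = LinearMap.id := by
      refine LinearMap.ext fun x => ?_
      rw [LinearMap.sum_apply]
      exact Finset.univ_sum_single x
    rw [this, dirLimMap_id]
  refine ⟨LinearEquiv.ofBijective (LinearMap.pi fun i => FMap (LinearMap.single (Lam p) M i))
    ⟨?_, ?_⟩⟩
  · intro φ ψ h
    refine AddMonoidHom.ext fun z => ?_
    let φ' : DirLim p (∀ i, M i) →+ QpModZp p := φ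
    let ψ' : DirLim p (∀ i, M i) →+ QpModZp p := ψ
    change φ' z = ψ' z
    rw [← hsum z, map_sum, map_sum]
    exact Finset.sum_congr rfl fun i _ =>
      DFunLike.congr_fun (F := DirLim p (M i) →+ QpModZp p) (congrFun h i) _
  · intro φ
    let φ' : ∀ i, DirLim p (M i) →+ QpModZp p := φ
    let ψ : DirLim p (∀ i, M i) →+ QpModZp p :=
      ∑ i, (φ' i).comp (dirLimMap (LinearMap.proj i : (∀ i, M i) →ₗ[Lam p] M i)).toAddMonoidHom
    suffices hψ : ∀ j (z : DirLim p (M j)),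
        ψ (dirLimMap (LinearMap.single (Lam p) M j) z) = φ' j z from
      ⟨ψ, funext fun j => AddMonoidHom.ext fun z => hψ j z⟩
    intro j z
    rw [AddMonoidHom.finsetSum_apply, Finset.sum_eq_single j]
    · change φ' j (dirLimMap (LinearMap.proj j) (dirLimMap (LinearMap.single (Lam p) M j) z)) = _
      rw [hδ, LinearMap.proj_comp_single_same, dirLimMap_id]
    · intro i _ hij
      change φ' i (dirLimMap (LinearMap.proj i) (dirLimMap (LinearMap.single (Lam p) M j) z)) = _
      rw [hδ, LinearMap.proj_comp_single_ne (Lam p) M i j hij, dirLimMap_zero, map_zero]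
    · exact fun h => absurd (Finset.mem_univ j) h

theorem nonempty_core_pi_equiv :
    Nonempty (core p (∀ i, M i) ≃ₗ[Lam p] ∀ i, core p (M i)) := by
  classical
  refine ⟨LinearEquiv.ofBijective (LinearMap.pi fun i => coreMap (LinearMap.proj i)) ⟨?_, ?_⟩⟩
  · intro x y h
    refine Subtype.ext (funext fun i => ?_)
    exact congrArg Subtype.val (congrFun h i)
  · intro y
    refine ⟨∑ i, coreMap (LinearMap.single (Lam p) M i) (y i), funext fun j => Subtype.ext ?_⟩
    change ((∑ i, coreMap (LinearMap.single (Lam p) M i) (y i) : core p (∀ i, M i)) : ∀ i, M i) j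
      = _
    rw [Submodule.coe_sum]
    exact congrFun (Finset.univ_sum_single fun i => (y i : M i)) j

end Products

/-! ### Twisted modules -/

section Twist

variable {M N : Type*} [AddCommGroup M] [Module (Lam p) M] [AddCommGroup N] [Module (Lam p) N]

/-- The identity `M → M^ι` is semilinear with respect to `ι`. -/
theorem finite_twist [Module.Finite (Lam p) M] : Module.Finite (Lam p) (Twist p M) := by
  have _ : RingHomSurjective (iota p : Lam p →+* Lam p) := ⟨fun a => ⟨iota p a, iota_iota a⟩⟩
  let u : M →ₛₗ[(iota p : Lam p →+* Lam p)] Twist p M :=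
    { toFun := fun m => m
      map_add' := fun _ _ => rfl
      map_smul' := fun c m => by
        change c • m = iota p (iota p c) • m
        rw [iota_iota] }
  exact Module.Finite.of_surjective u fun m => ⟨m, rfl⟩

/-- The linear map `M^ι → N^ι` with the same values as a linear map `M → N`. -/
def twistMap (u : M →ₗ[Lam p] N) : Twist p M →ₗ[Lam p] Twist p N where
  toFun := u
  map_add' := map_add u
  map_smul' c := map_smul u (iota p c)

theorem HasPseudoIso.twist (h : HasPseudoIso p M N) :
    HasPseudoIso p (Twist p M) (Twist p N) := by
  obtain ⟨u, hu1, hu2⟩ := h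
  refine ⟨twistMap u, hu1, ?_⟩
  refine Finite.of_surjective (fun y : N ⧸ LinearMap.range u =>
    (Submodule.Quotient.mk (p := LinearMap.range (twistMap u)) y.out)) fun z => ?_
  obtain ⟨z, rfl⟩ := Submodule.Quotient.mk_surjective _ z
  refine ⟨Submodule.Quotient.mk (p := LinearMap.range u) z, ?_⟩
  refine (Submodule.Quotient.eq (LinearMap.range (twistMap u))).mpr ?_
  exact (Submodule.Quotient.eq (LinearMap.range u)).mp (Quotient.out_eq _)

theorem nonempty_pi_cyc_equiv_twist {κ : Type*} (h : κ → Lam p) :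
    Nonempty ((∀ k, cyc (h k)) ≃ₗ[Lam p] Twist p (∀ k, cyc (iota p (h k)))) := by
  have e : ∀ k, cyc (h k) ≃ₗ[Lam p] Twist p (cyc (iota p (h k))) := fun k =>
    (nonempty_twist_cyc_equiv (h k)).some
  exact ⟨{ toFun := fun x k => e k (x k)
           map_add' := fun x y => funext fun k => map_add (e k) (x k) (y k)
           map_smul' := fun c x => funext fun k => map_smul (e k) c (x k)
           invFun := fun y k => (e k).symm (y k)
           left_inv := fun x => funext fun k => (e k).symm_apply_apply (x k)
           right_inv := fun y => funext fun k => (e k).apply_symm_apply (y k) }⟩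

end Twist

/-! ### The functors up to pseudo-isomorphism -/

section Families

variable {κ : Type*} [Fintype κ] {f h : κ → Lam p}

theorem nonempty_F_pi_cyc_equiv (H : ∀ k, IsAdjointPair (f k) (h k)) :
    Nonempty ((∀ k, cyc (iota p (h k))) ≃ₗ[Lam p] F p (∀ k, cyc (f k))) := by
  obtain ⟨e⟩ := nonempty_F_pi_equiv (p := p) fun k => cyc (f k)
  exact ⟨(LinearEquiv.piCongrRight fun k => (H k).nonempty_F_equiv.some).trans e.symm⟩

theorem nonempty_core_pi_cyc_equiv (H : ∀ k, IsAdjointPair (f k) (h k)) :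
    Nonempty (core p (∀ k, cyc (f k)) ≃ₗ[Lam p] ∀ k, cyc (h k)) := by
  obtain ⟨e⟩ := nonempty_core_pi_equiv (p := p) fun k => cyc (f k)
  exact ⟨e.trans (LinearEquiv.piCongrRight fun k => (H k).nonempty_core_equiv.some.symm)⟩

variable {X : Type*} [AddCommGroup X] [Module (Lam p) X]

/-- The direct sum of the `Λ / ι(h)` embeds into `𝔉(X)` with finite cokernel. -/
theorem exists_injective_finite_coker (H : ∀ k, IsAdjointPair (f k) (h k))
    (hX : HasPseudoIso p X (∀ k, cyc (f k))) :
    ∃ v : (∀ k, cyc (iota p (h k))) →ₗ[Lam p] F p X,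
      Function.Injective v ∧ Finite (F p X ⧸ LinearMap.range v) := by
  obtain ⟨u, hu1, hu2⟩ := hX
  obtain ⟨e⟩ := nonempty_F_pi_cyc_equiv H
  refine ⟨FMap u ∘ₗ e.toLinearMap, (FMap_injective u).comp e.injective, ?_⟩
  rw [LinearMap.range_comp_of_range_eq_top _ e.range]
  exact finite_coker_FMap u

variable [Module.Finite (Lam p) X]

theorem hasPseudoIso_G_pi (H : ∀ k, IsAdjointPair (f k) (h k))
    (hX : HasPseudoIso p X (∀ k, cyc (f k))) : HasPseudoIso p (G p X) (∀ k, cyc (h k)) := by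
  obtain ⟨u, hu1, hu2⟩ := hX
  obtain ⟨e⟩ := nonempty_core_pi_cyc_equiv H
  have _ : Module.Finite (Lam p) (G p X) := Module.Finite.equiv (coreEquiv (p := p) (X := X))
  exact ((hasPseudoIso_of_equiv (coreEquiv (p := p) (X := X)).symm).trans (hasPseudoIso_core u)).trans
    (hasPseudoIso_of_equiv e)

end Families

section Annihilators

variable {M N : Type*} [AddCommGroup M] [Module (Lam p) M] [AddCommGroup N] [Module (Lam p) N]

theorem HasPseudoIso.exists_annihilator_left (h : HasPseudoIso p M N) {a : Lam p} (ha : a ≠ 0)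
    (haN : ∀ y : N, a • y = 0) : ∃ b : Lam p, b ≠ 0 ∧ ∀ x : M, b • x = 0 := by
  obtain ⟨u, hu1, hu2⟩ := h
  obtain ⟨k, hk⟩ := exists_controls u
  refine ⟨(p : Lam p) ^ k * a, mul_ne_zero (pow_ne_zero _ prime_natCast.ne_zero) ha, fun x => ?_⟩
  rw [mul_smul]
  exact (hk _ natCast_mem_maximalIdeal).1 _ (by rw [map_smul, haN])

theorem HasPseudoIso.exists_annihilator_right (h : HasPseudoIso p M N) {a : Lam p} (ha : a ≠ 0)
    (haM : ∀ x : M, a • x = 0) : ∃ b : Lam p, b ≠ 0 ∧ ∀ y : N, b • y = 0 := by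
  obtain ⟨u, hu1, hu2⟩ := h
  obtain ⟨k, hk⟩ := exists_controls u
  refine ⟨a * (p : Lam p) ^ k, mul_ne_zero ha (pow_ne_zero _ prime_natCast.ne_zero), fun y => ?_⟩
  obtain ⟨x, hx⟩ := (hk _ natCast_mem_maximalIdeal).2 y
  rw [mul_smul, ← hx, ← map_smul, haM, map_zero]

end Annihilators

theorem exists_annihilator_pi_cyc {κ : Type*} [Fintype κ] {h : κ → Lam p} (hh : ∀ k, h k ≠ 0) :
    ∃ a : Lam p, a ≠ 0 ∧ ∀ x : ∀ k, cyc (h k), a • x = 0 := by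
  refine ⟨∏ k, h k, Finset.prod_ne_zero_iff.mpr fun k _ => hh k, fun x => funext fun k => ?_⟩
  obtain ⟨c, hc⟩ := Submodule.Quotient.mk_surjective _ (x k)
  rw [Pi.smul_apply, ← hc, Pi.zero_apply, ← Submodule.Quotient.mk_smul,
    Submodule.Quotient.mk_eq_zero, Ideal.mem_span_singleton]
  exact (Finset.dvd_prod_of_mem h (Finset.mem_univ k)).mul_right c

/-! ### Explicit elementary modules -/

/-- A free module is a product of the modules `Λ / 0`. -/
def piCycZeroEquiv (α : Type*) : (α → Lam p) ≃ₗ[Lam p] (α → cyc (0 : Lam p)) :=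
  LinearEquiv.piCongrRight fun _ =>
    (Submodule.quotEquivOfEqBot (Ideal.span {(0 : Lam p)}) (by simp)).symm

/-- The product of the `Λ / a_i` and the `Λ / b_j`, as a product over the disjoint union. -/
def piCycSumEquiv {α β : Type*} (a : α → Lam p) (b : β → Lam p) :
    (∀ k, cyc (Sum.elim a b k)) ≃ₗ[Lam p] (∀ i, cyc (a i)) × (∀ j, cyc (b j)) :=
  LinearEquiv.sumPiEquivProdPi (Lam p) α β fun k => cyc (Sum.elim a b k)

/-- The factors `Λ / 1` of a product of cyclic modules may be left out. -/
def piCycOneEquiv {β γ : Type*} (α δ : Type*) (b : β → Lam p) (c : γ → Lam p) :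
    ((∀ i, cyc (b i)) × (∀ i, cyc (c i))) ≃ₗ[Lam p]
      ∀ k, cyc (Sum.elim (fun _ : α => 1) (Sum.elim b (Sum.elim c fun _ : δ => 1)) k) :=
  have _ : Subsingleton (cyc (1 : Lam p)) := subsingleton_cyc isUnit_one
  have _ : Unique (α → cyc (1 : Lam p)) := Unique.mk' _
  have _ : Unique (δ → cyc (1 : Lam p)) := Unique.mk' _
  ((piCycSumEquiv _ _).trans (LinearEquiv.uniqueProd.trans ((piCycSumEquiv _ _).trans
    ((LinearEquiv.refl _ _).prodCongr ((piCycSumEquiv _ _).trans LinearEquiv.prodUnique))))).symm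

theorem isAdjointPair_zero : IsAdjointPair (0 : Lam p) 1 := Or.inl ⟨rfl, isUnit_one⟩

/-- The elementary module attached to `X`, as a product of cyclic modules with known `𝔉` and `𝔊`. -/
theorem exists_hasPseudoIso_isAdjointPair (X : Type*) [AddCommGroup X] [Module (Lam p) X]
    [Module.Finite (Lam p) X] : ∃ (κ : Type) (_ : Fintype κ) (f h : κ → Lam p),
      (∀ k, IsAdjointPair (f k) (h k)) ∧ HasPseudoIso p X (∀ k, cyc (f k)) := by
  obtain ⟨r, ι, _, q, e, hq, hX⟩ := exists_hasPseudoIso_elementary (p := p) X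
  choose h hh using fun i => exists_isAdjointPair_pow (hq i) (e i)
  refine ⟨Fin r ⊕ ι, inferInstance, Sum.elim (fun _ => 0) fun i => q i ^ e i,
    Sum.elim (fun _ => 1) h, ?_, hX.trans (hasPseudoIso_of_equiv ?_)⟩
  · rintro (k | k)
    exacts [isAdjointPair_zero, hh k]
  · exact ((piCycZeroEquiv (Fin r)).prodCongr (LinearEquiv.refl _ _)).trans
      (piCycSumEquiv _ _).symm

/-- The embedding for the explicit elementary module: only the factors prime to all `ω_n` and the
repeated cyclotomic factors contribute to `𝔉(X)`. -/
theorem exists_injective_of_elementary {X : Type*} [AddCommGroup X] [Module (Lam p) X]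
    [Module.Finite (Lam p) X] {r d f t : ℕ} {g : Fin d → Lam p} {l : Fin d → ℕ}
    {a : Fin f → ℕ} {e : Fin f → ℕ} {b : Fin t → ℕ} (hg : ∀ i, Prime (g i))
    (hgω : ∀ i n, IsRelPrime (g i) (omega p n)) (he : ∀ m, 2 ≤ e m)
    (hX : HasPseudoIso p X ((Fin r → Lam p) × (∀ i, cyc (g i ^ l i)) ×
      (∀ m, cyc (xi p (a m) ^ e m)) × (∀ n, cyc (xi p (b n))))) :
    ∃ v : ((∀ i, cyc (iota p (g i) ^ l i)) × (∀ m, cyc (iota p (xi p (a m)) ^ (e m - 1))))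
        →ₗ[Lam p] F p X,
      Function.Injective v ∧ Finite (F p X ⧸ LinearMap.range v) := by
  have H : ∀ k, IsAdjointPair
      (Sum.elim (fun _ : Fin r => 0) (Sum.elim (fun i => g i ^ l i)
        (Sum.elim (fun m => xi p (a m) ^ e m) fun n => xi p (b n))) k)
      (Sum.elim (fun _ : Fin r => 1) (Sum.elim (fun i => g i ^ l i)
        (Sum.elim (fun m => xi p (a m) ^ (e m - 1)) fun _ : Fin t => 1)) k) := by
    rintro (i | i | m | n)
    · exact isAdjointPair_zero
    · exact isAdjointPair_pow_of_isRelPrime (hg i).ne_zero (hgω i) (l i)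
    · have := isAdjointPair_pow_of_dvd (xi_dvd_omega (p := p) (a m)) (e m - 1)
      rwa [Nat.sub_add_cancel (one_le_two.trans (he m))] at this
    · simpa using isAdjointPair_pow_of_dvd (xi_dvd_omega (p := p) (b n)) 0
  obtain ⟨v, hv1, hv2⟩ := exists_injective_finite_coker H (hX.trans (hasPseudoIso_of_equiv
    (((piCycZeroEquiv (Fin r)).prodCongr ((LinearEquiv.refl _ _).prodCongr
      (piCycSumEquiv _ _).symm)).trans (((LinearEquiv.refl _ _).prodCongr
        (piCycSumEquiv _ _).symm).trans (piCycSumEquiv _ _).symm))))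
  have h1 : (fun k => iota p (Sum.elim (fun _ : Fin r => 1) (Sum.elim (fun i => g i ^ l i)
        (Sum.elim (fun m => xi p (a m) ^ (e m - 1)) fun _ : Fin t => 1)) k))
      = Sum.elim (fun _ => 1) (Sum.elim (fun i => iota p (g i) ^ l i)
        (Sum.elim (fun m => iota p (xi p (a m)) ^ (e m - 1)) fun _ => 1)) := by
    refine funext ?_
    rintro (i | i | m | n) <;> simp
  have E := piCycOneEquiv (Fin r) (Fin t) (fun i => iota p (g i) ^ l i)
    fun m => iota p (xi p (a m)) ^ (e m - 1)
  rw [← h1] at E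
  refine ⟨v ∘ₗ E.toLinearMap, hv1.comp E.injective, ?_⟩
  rwa [LinearMap.range_comp_of_range_eq_top _ E.range]

end

end IwasawaFunctors

open IwasawaFunctors in
theorem propositionA1p6 (p : ℕ) [Fact p.Prime] (hp : p ≠ 2)
    (X : Type*) [AddCommGroup X] [Module (Lam p) X] [Module.Finite (Lam p) X] :
    (∀ (r d f t : ℕ) (g : Fin d → Lam p) (l : Fin d → ℕ)
        (a : Fin f → ℕ) (e : Fin f → ℕ) (b : Fin t → ℕ),
      (∀ i, Prime (g i)) → (∀ i n, IsRelPrime (g i) (omega p n)) → (∀ i, 1 ≤ l i) →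
      (∀ m, 2 ≤ e m) →
      HasPseudoIso p X ((Fin r → Lam p) × (∀ i, cyc (g i ^ l i)) ×
          (∀ m, cyc (xi p (a m) ^ e m)) × (∀ n, cyc (xi p (b n)))) →
      ∃ v : ((∀ i, cyc (iota p (g i) ^ l i)) × (∀ m, cyc (iota p (xi p (a m)) ^ (e m - 1))))
          →ₗ[Lam p] F p X,
        Function.Injective v ∧ Finite (F p X ⧸ LinearMap.range v)) ∧
    Module.Finite (Lam p) (F p X) ∧
    Module.IsTorsion (Lam p) (F p X) ∧
    HasPseudoIso p (Twist p (F p X)) (G p X) ∧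
    HasPseudoIso p (G p X) (Twist p (F p X)) := by
  refine ⟨fun r d f t g l a e b hg hgω _ he hX => exists_injective_of_elementary hg hgω he hX, ?_⟩
  -- `𝔊(X)` and `𝔉(X)^ι` are both compared with the direct sum of the `Λ / h k`
  obtain ⟨κ, _, f, h, H, hX⟩ := exists_hasPseudoIso_isAdjointPair (p := p) X
  obtain ⟨v, hv1, hv2⟩ := exists_injective_finite_coker H hX
  have hF : Module.Finite (Lam p) (F p X) :=
    Module.Finite.of_submodule_quotient (LinearMap.range v)
  have hv : HasPseudoIso p (∀ k, cyc (iota p (h k))) (F p X) :=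
    ⟨v, by rw [LinearMap.ker_eq_bot.mpr hv1]; infer_instance, hv2⟩
  have _ : Module.Finite (Lam p) (Twist p (F p X)) := finite_twist
  have _ : Module.Finite (Lam p) (G p X) := Module.Finite.equiv (coreEquiv (p := p) (X := X))
  have hG := hasPseudoIso_G_pi H hX
  obtain ⟨e⟩ := nonempty_pi_cyc_equiv_twist h
  have hGF : HasPseudoIso p (∀ k, cyc (h k)) (Twist p (F p X)) :=
    (hasPseudoIso_of_equiv e).trans hv.twist
  obtain ⟨c, hc, hcx⟩ := exists_annihilator_pi_cyc fun k => (H k).ne_zero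
  obtain ⟨a, ha, haG⟩ := hG.exists_annihilator_left hc hcx
  obtain ⟨b, hb, hbF⟩ := hGF.exists_annihilator_right hc hcx
  have hpi := hG.trans hGF
  -- `b` acts on `𝔉(X)^ι` as `ι(b)` acts on `𝔉(X)`
  refine ⟨hF, fun {x} => ⟨⟨iota p b, mem_nonZeroDivisors_of_ne_zero (iota_ne_zero hb)⟩, hbF x⟩,
    hpi.symm (mul_ne_zero ha hb) (fun x => ?_) (fun y => ?_), hpi⟩
  · rw [mul_comm, mul_smul, haG, smul_zero]
  · rw [mul_smul, hbF, smul_zero]
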